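/- Let $n,N$ be positive integers with $N\ge n$, let $\theta\in\mathbb R^n$, $C\in\mathbb R$, $\beta>0$, $M<\infty$, $\delta>0$, and let $(\phi_k)_{k\ge1}$ be a (deterministic) sequence in $\mathbb R^n$ such that $$\sup_{k\ge 1}\|\phi_k\|\le M,\qquad \frac1N\sum_{i=k}^{k+N-1}\phi_i\phi_i^\top\ \ge\ \delta I_n\quad\text{for all }k\ge1 .$$ Let $(d_k)_{k\ge1}$ be i.i.d. real random variables with zero mean and finite variance, whose distribution function $F$ is Lipschitz continuous and which have a density $f$ with $\inf_{x\in\mathfrak X}f(x)>0$ for every bounded (nonempty) open set $\mathfrak X\subset\mathbb R$. Put $$y_k=\phi_k^\top\theta+d_k,\qquad s_k=\begin{cases}1,& y_k\le C,\\ 0,& y_k>C,\end{cases}\qquad k\ge1,$$ let $\hat\theta_0$ be an arbitrary (possibly random) initial estimate, and define $$\hat\theta_k=\hat\theta_{k-1}+\frac{\beta\phi_k}{k}\Big(F\big(C-\phi_k^\top\hat\theta_{k-1}\big)-s_k\Big),\qquad \tilde\theta_k=\hat\theta_k-\theta,\qquad k\ge1 .$$ Let $$\underline f=\lim_{z\to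 (M\|\theta\|)^+}\ \inf_{t\in[C-z,\,C+z]}f(t),\qquad \eta=\beta\delta\underline f .$$ Then for every $\varepsilon>0$, almost surely as $k\to\infty$, $$\tilde\theta_k=\begin{cases}O\big(\sqrt{\ln\ln k/k}\big),&\eta>\tfrac12,\\[2pt] O\big(k^{-(\eta-\varepsilon)}\big),&\eta\le\tfrac12.\end{cases}$$ If moreover $f$ is locally Lipschitz continuous, then almost surely as $k\to\infty$, $$\tilde\theta_k=\begin{cases}O\big(\sqrt{\ln\ln k/k}\big),&\eta>\tfrac12,\\[2pt] O\big(\ln k\,\sqrt{\ln\ln k/k}\big),&\eta=\tfrac12,\\[2pt] O\big(k^{-\eta}\big),&\eta<\tfrac12.\end{cases}$$ -/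

import Mathlib

open scoped Topology
open Filter MeasureTheory ProbabilityTheory Asymptotics

namespace SetValued

/-- Uniformly bounded regressors (indexed by `k ≥ 1`) with uniform persistent excitation:
`(1/N) ∑_{i=k}^{k+N-1} φ_i φ_iᵀ ≥ δ I_n` in the Loewner order, for every `k ≥ 1`. -/
structure PersistentExcitation {n : ℕ} (φ : ℕ → EuclideanSpace ℝ (Fin n))
    (M δ : ℝ) (N : ℕ) : Prop where
  bounded : ∀ k, 1 ≤ k → ‖φ k‖ ≤ M
  window_pos : 0 < N
  dim_le_window : n ≤ N
  delta_pos : 0 < δ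
  exciting : ∀ k, 1 ≤ k →
    ((1 / (N : ℝ)) • ∑ i ∈ Finset.Ico k (k + N), Matrix.vecMulVec (φ i).ofLp (φ i).ofLp
      - δ • (1 : Matrix (Fin n) (Fin n) ℝ)).PosSemidef

/-- The noise `d_1, d_2, …` is i.i.d. with zero mean and finite variance, its distribution
function `F` is Lipschitz, and `f` is a density of it which is bounded below by a positive
constant on each bounded open set. -/
structure NoiseAssumption {Ω : Type*} [MeasurableSpace Ω] (μ : Measure Ω)
    (d : ℕ → Ω → ℝ) (F f : ℝ → ℝ) : Prop where
  measurable : ∀ k, 1 ≤ k → Measurable (d k)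
  indep : iIndepFun (fun k : ℕ => d (k + 1)) μ
  identDistrib : ∀ k, 1 ≤ k → IdentDistrib (d k) (d 1) μ μ
  finite_variance : MemLp (d 1) 2 μ
  mean_zero : ∫ ω, d 1 ω ∂μ = 0
  distribution : ∀ x, F x = μ.real {ω | d 1 ω ≤ x}
  lipschitz : ∃ K, LipschitzWith K F
  density_measurable : Measurable f
  density : μ.map (d 1) = volume.withDensity (fun x => ENNReal.ofReal (f x))
  density_inf_pos : ∀ X : Set ℝ, IsOpen X → Bornology.IsBounded X →
    ∃ c : ℝ, 0 < c ∧ ∀ x ∈ X, c ≤ f x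

/-- The system output `y_k = φ_kᵀ θ + d_k`. -/
noncomputable def output {n : ℕ} {Ω : Type*} (φ : ℕ → EuclideanSpace ℝ (Fin n))
    (θ : EuclideanSpace ℝ (Fin n)) (d : ℕ → Ω → ℝ) (k : ℕ) (ω : Ω) : ℝ :=
  inner ℝ (φ k) θ + d k ω

/-- The binary observation `s_k`, equal to `1` if `y_k ≤ C` and to `0` if `y_k > C`. -/
noncomputable def observation {n : ℕ} {Ω : Type*} (φ : ℕ → EuclideanSpace ℝ (Fin n))
    (θ : EuclideanSpace ℝ (Fin n)) (d : ℕ → Ω → ℝ) (C : ℝ) (k : ℕ) (ω : Ω) : ℝ :=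
  if output φ θ d k ω ≤ C then 1 else 0

/-- The recursion `x_k = x_{k-1} + (β φ_k / k) (F (C - φ_kᵀ x_{k-1}) - s_k)`, `k ≥ 1`,
driven by a sequence of observations `s`, started at `x₀`. -/
noncomputable def recursion {n : ℕ} (β C : ℝ) (F : ℝ → ℝ)
    (φ : ℕ → EuclideanSpace ℝ (Fin n)) (s : ℕ → ℝ) (x₀ : EuclideanSpace ℝ (Fin n)) :
    ℕ → EuclideanSpace ℝ (Fin n)
  | 0 => x₀
  | k + 1 => recursion β C F φ s x₀ k +
      (β / ((k + 1 : ℕ) : ℝ) *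
        (F (C - inner ℝ (φ (k + 1)) (recursion β C F φ s x₀ k)) - s (k + 1))) • φ (k + 1)

/-- The estimate of `θ` at time `k`, with initial estimate `θ₀`. -/
noncomputable def estimate {n : ℕ} {Ω : Type*} (β C : ℝ) (F : ℝ → ℝ)
    (φ : ℕ → EuclideanSpace ℝ (Fin n)) (θ : EuclideanSpace ℝ (Fin n)) (d : ℕ → Ω → ℝ)
    (θ₀ : Ω → EuclideanSpace ℝ (Fin n)) (k : ℕ) (ω : Ω) : EuclideanSpace ℝ (Fin n) :=
  recursion β C F φ (fun j => observation φ θ d C j ω) (θ₀ ω) k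

/-- The estimation error at time `k`: the estimate minus `θ`. -/
noncomputable def estimationError {n : ℕ} {Ω : Type*} (β C : ℝ) (F : ℝ → ℝ)
    (φ : ℕ → EuclideanSpace ℝ (Fin n)) (θ : EuclideanSpace ℝ (Fin n)) (d : ℕ → Ω → ℝ)
    (θ₀ : Ω → EuclideanSpace ℝ (Fin n)) (k : ℕ) (ω : Ω) : EuclideanSpace ℝ (Fin n) :=
  estimate β C F φ θ d θ₀ k ω - θ

/-- `lowerDensity f C a = lim_{z → a⁺} inf_{t ∈ [C - z, C + z]} f t`. -/
noncomputable def lowerDensity (f : ℝ → ℝ) (C a : ℝ) : ℝ :=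
  limUnder (𝓝[>] a) (fun z => sInf (f '' Set.Icc (C - z) (C + z)))

/-- The limit that defines `lowerDensity` exists. -/
theorem tendsto_lowerDensity {f : ℝ → ℝ} (hf : ∀ x, 0 ≤ f x) (C : ℝ) {a : ℝ} (ha : 0 ≤ a) :
    Tendsto (fun z => sInf (f '' Set.Icc (C - z) (C + z))) (𝓝[>] a)
      (𝓝 (lowerDensity f C a)) := by
  have hbdd : ∀ s : Set ℝ, BddBelow (f '' s) := fun s =>
    ⟨0, by rintro _ ⟨x, -, rfl⟩; exact hf x⟩
  have hanti : AntitoneOn (fun z => sInf (f '' Set.Icc (C - z) (C + z))) (Set.Ioi a) := by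
    intro z hz w hw hzw
    have hz' : a < z := hz
    refine csInf_le_csInf (hbdd _) ⟨f C, C, ⟨by linarith, by linarith⟩, rfl⟩ ?_
    exact Set.image_mono (Set.Icc_subset_Icc (by linarith) (by linarith))
  have hub : BddAbove ((fun z => sInf (f '' Set.Icc (C - z) (C + z))) '' Set.Ioi a) := by
    refine ⟨f C, ?_⟩
    rintro _ ⟨z, hz, rfl⟩
    have hz' : a < z := hz
    exact csInf_le (hbdd _) ⟨C, ⟨by linarith, by linarith⟩, rfl⟩
  exact tendsto_nhds_limUnder ⟨_, hanti.tendsto_nhdsGT hub⟩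

end SetValued

/-! Write the error as x_k. With a secant slope of `F` in place of its derivative, x_k obeys a
linear recursion x_{k+1} = x_k - (a_{k+1}/(k+1)) ⟪φ_{k+1}, x_k⟫ φ_{k+1} + (β/(k+1)) w_{k+1} φ_{k+1}.
The gains a depend on the state, and the noises w are bounded, independent and centred. Everything
random is confined to one almost sure event: S_k = ∑ w_i φ_i is O(√(k ln ln k)), the upper half of
the law of the iterated logarithm (`ae_sum_noise_isBigO`). The rest is deterministic.

Summation by parts (`ErrorRecursion.exists_shift`) uses up the cancellation in the noise: z_k = x_k
- (β/k) S_k solves the same recursion with perturbations e_k = O(√(ln ln k) k^(-3/2)), and x_k - z_k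
already has the optimal order. If the gains are eventually at least α, excitation contracts the
homogeneous recursion over a window of length N by exp(-αδN/m + O(1/m²)). The second-order factors
have a convergent product, so k^(αδ) ‖z_k‖ is bounded by a constant times 1 + ∑_{i≤k} i^(αδ) ‖e_i‖
(`exists_rpow_mul_norm_le`). This sum converges for αδ < 1/2, costs a logarithm at 1/2, and is of
order k^(αδ-1/2) √(ln ln k) for 1/2 < αδ ≤ 1.

The gain bound comes from a bootstrap. Steps with nonnegative gains are eventually nonexpansive, so
x is bounded; the density is then bounded below on the range in question, so x → 0
(`ErrorRecursion.tendsto_zero`); hence the gains eventually exceed every α below β times the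
limiting lower density. This gives the first set of rates, with the loss of ε only when η ≤ 1/2. If
f is locally Lipschitz, the gains fall short of their limiting bound by at most O(‖x_k‖). Raising
them to that bound costs a perturbation of order k^(-1-2s), where k^(-s) is a rate already known,
and this is small enough to reach the exponent η itself
(`ErrorRecursion.exists_shift_of_lipschitz`). -/

namespace SetValued

/-! ### Upper law of the iterated logarithm for bounded independent variables -/

section LIL

variable {Ω : Type*} [MeasurableSpace Ω] {μ : Measure Ω} [IsProbabilityMeasure μ]
  {X : ℕ → Ω → ℝ} {B : ℝ}

theorem integrable_exp_mul_of_abs_le (hX : ∀ i, Measurable (X i)) (hb : ∀ i ω, |X i ω| ≤ B)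
    (t : ℝ) (s : Finset ℕ) : Integrable (fun ω => Real.exp (t * ∑ i ∈ s, X i ω)) μ := by
  have hm : Measurable (fun ω => Real.exp (t * ∑ i ∈ s, X i ω)) := by fun_prop
  refine Integrable.of_bound hm.aestronglyMeasurable (Real.exp (|t| * (s.card * B))) ?_
  refine ae_of_all _ fun ω => ?_
  rw [Real.norm_eq_abs, abs_of_pos (Real.exp_pos _), Real.exp_le_exp]
  refine (le_abs_self _).trans ?_
  rw [abs_mul]
  refine mul_le_mul_of_nonneg_left ?_ (abs_nonneg _)
  refine (Finset.abs_sum_le_sum_abs _ _).trans ((Finset.sum_le_sum fun i _ => hb i ω).trans ?_)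
  simp

/-- The new factor is independent of the past, and its mean is at least 1 because e^y ≥ 1 + y and
the variables are centred. -/
theorem submartingale_exp_sum (hX : ∀ i, Measurable (X i)) (hind : iIndepFun X μ)
    (hb : ∀ i ω, |X i ω| ≤ B) (h0 : ∀ i, ∫ ω, X i ω ∂μ = 0) (t : ℝ) :
    Submartingale (fun n ω => Real.exp (t * ∑ i ∈ Finset.range (n + 1), X i ω))
      (Filtration.natural X fun i => (hX i).stronglyMeasurable) μ := by
  have hadp : ∀ n, Measurable[Filtration.natural X (fun i => (hX i).stronglyMeasurable) n]
      (fun ω => Real.exp (t * ∑ i ∈ Finset.range (n + 1), X i ω)) := by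
    intro n
    refine Real.measurable_exp.comp (Measurable.const_mul ?_ t)
    refine Finset.measurable_fun_sum _ fun i hi => ?_
    have := (Filtration.stronglyAdapted_natural
      (fun i => (hX i).stronglyMeasurable)) i
    exact this.measurable.mono (Filtration.mono _ (by simpa [Nat.lt_succ_iff] using hi)) le_rfl
  refine submartingale_of_setIntegral_le_succ (fun n => (hadp n).stronglyMeasurable)
    (fun n => integrable_exp_mul_of_abs_le hX hb t _) fun n s hs => ?_
  set 𝒢 := Filtration.natural X (fun i => (hX i).stronglyMeasurable)
  have hs' : MeasurableSet s := 𝒢.le n _ hs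
  rw [← integral_indicator hs', ← integral_indicator hs']
  have hA : Measurable[𝒢 n]
      (s.indicator fun ω => Real.exp (t * ∑ i ∈ Finset.range (n + 1), X i ω)) :=
    (hadp n).indicator hs
  have hindep : IndepFun
      (s.indicator fun ω => Real.exp (t * ∑ i ∈ Finset.range (n + 1), X i ω))
      (fun ω => Real.exp (t * X (n + 1) ω)) μ := by
    have h1 : IndepFun (s.indicator fun ω => Real.exp (t * ∑ i ∈ Finset.range (n + 1), X i ω))
        (X (n + 1)) μ := by
      have h2 := hind.indep_comap_natural_of_lt (fun i => (hX i).stronglyMeasurable)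
        (Nat.lt_succ_self n)
      rw [IndepFun_iff_Indep]
      exact (indep_of_indep_of_le_right h2 hA.comap_le).symm
    exact h1.comp measurable_id (ψ := fun x : ℝ => Real.exp (t * x)) (by fun_prop)
  have hprod : (s.indicator fun ω => Real.exp (t * ∑ i ∈ Finset.range (n + 1 + 1), X i ω)) =
      (s.indicator fun ω => Real.exp (t * ∑ i ∈ Finset.range (n + 1), X i ω)) *
        fun ω => Real.exp (t * X (n + 1) ω) := by
    funext ω
    by_cases hω : ω ∈ s
    · simp [hω, Finset.sum_range_succ _ (n + 1), mul_add, Real.exp_add]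
    · simp [hω]
  have hE : 1 ≤ ∫ ω, Real.exp (t * X (n + 1) ω) ∂μ := by
    have hi : Integrable (fun ω => Real.exp (t * X (n + 1) ω)) μ := by
      simpa using integrable_exp_mul_of_abs_le (μ := μ) hX hb t {n + 1}
    have hXi : Integrable (X (n + 1)) μ :=
      Integrable.of_bound (hX _).aestronglyMeasurable B (ae_of_all _ fun ω => hb _ ω)
    calc (1 : ℝ) = ∫ ω, (t * X (n + 1) ω + 1) ∂μ := by
          rw [integral_add (hXi.const_mul t) (integrable_const _), integral_const_mul, h0]; simp
      _ ≤ _ := integral_mono ((hXi.const_mul t).add (integrable_const _)) hi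
          fun ω => Real.add_one_le_exp _
  rw [hprod, hindep.integral_mul_eq_mul_integral
    (hA.mono (𝒢.le n) le_rfl).aestronglyMeasurable
    (by fun_prop)]
  refine le_mul_of_one_le_right (integral_nonneg fun ω => ?_) hE
  exact Set.indicator_nonneg (fun _ _ => (Real.exp_pos _).le) _

/-- Doob's maximal inequality for the exponential submartingale, with Hoeffding's lemma bounding its
final mean: each variable is sub-Gaussian with variance proxy B². -/
theorem measure_exists_sum_ge_le (hX : ∀ i, Measurable (X i)) (hind : iIndepFun X μ)
    (hb : ∀ i ω, |X i ω| ≤ B) (h0 : ∀ i, ∫ ω, X i ω ∂μ = 0) {t : ℝ} (ht : 0 ≤ t)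
    (a : ℝ) (n : ℕ) :
    μ {ω | ∃ k ≤ n, a ≤ ∑ i ∈ Finset.range (k + 1), X i ω} ≤
      ENNReal.ofReal (Real.exp (-(t * a) + (n + 1) * B ^ 2 * t ^ 2 / 2)) := by
  have hsub := submartingale_exp_sum hX hind hb h0 t
  have hmax := maximal_ineq hsub (fun n ω => (Real.exp_pos _).le)
    (ε := ⟨Real.exp (t * a), (Real.exp_pos _).le⟩) n
  set E := {ω | ((⟨Real.exp (t * a), (Real.exp_pos _).le⟩ : NNReal) : ℝ) ≤
    (Finset.range (n + 1)).sup' Finset.nonempty_range_add_one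
      fun k => Real.exp (t * ∑ i ∈ Finset.range (k + 1), X i ω)} with hE
  have hsubset : {ω | ∃ k ≤ n, a ≤ ∑ i ∈ Finset.range (k + 1), X i ω} ⊆ E := by
    rintro ω ⟨k, hk, hak⟩
    simp only [hE, Set.mem_ofPred_eq, Finset.le_sup'_iff]
    exact ⟨k, by simpa [Nat.lt_succ_iff] using hk,
      Real.exp_le_exp.2 (mul_le_mul_of_nonneg_left hak ht)⟩
  have hB : 0 ≤ B := by
    obtain ⟨ω⟩ : Nonempty Ω := μ.nonempty_of_neZero
    exact (abs_nonneg _).trans (hb 0 ω)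
  have hmgf : ∫ ω, Real.exp (t * ∑ i ∈ Finset.range (n + 1), X i ω) ∂μ ≤
      Real.exp ((n + 1) * B ^ 2 * t ^ 2 / 2) := by
    have hs := HasSubgaussianMGF.sum_of_iIndepFun hind (s := Finset.range (n + 1))
      (c := fun _ => (‖B - (-B)‖₊ / 2) ^ 2) (fun i _ =>
        hasSubgaussianMGF_of_mem_Icc_of_integral_eq_zero (a := -B) (b := B) (hX i).aemeasurable
          (ae_of_all _ fun ω => abs_le.1 (hb i ω)) (h0 i))
    refine (hs.mgf_le t).trans (le_of_eq ?_)
    have : |B + B| / 2 = B := by rw [abs_of_nonneg (by linarith)]; ring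
    simp [this]
  have hint : ∫ ω in E, Real.exp (t * ∑ i ∈ Finset.range (n + 1), X i ω) ∂μ ≤
      Real.exp ((n + 1) * B ^ 2 * t ^ 2 / 2) :=
    (setIntegral_le_integral (integrable_exp_mul_of_abs_le hX hb t _)
      (ae_of_all _ fun ω => (Real.exp_pos _).le)).trans hmgf
  have h1 : ENNReal.ofReal (Real.exp (t * a)) * μ E ≤
      ENNReal.ofReal (Real.exp ((n + 1) * B ^ 2 * t ^ 2 / 2)) := by
    refine le_trans (le_of_eq ?_) (hmax.trans (ENNReal.ofReal_le_ofReal hint))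
    rw [ENNReal.ofReal, Real.toNNReal_of_nonneg (Real.exp_pos _).le]
    rfl
  refine (measure_mono hsubset).trans ?_
  rw [Real.exp_add, ENNReal.ofReal_mul (Real.exp_pos _).le, Real.exp_neg,
    ENNReal.ofReal_inv_of_pos (Real.exp_pos _), mul_comm, ← div_eq_mul_inv,
    ENNReal.le_div_iff_mul_le (Or.inl (by simp [Real.exp_pos])) (Or.inl ENNReal.ofReal_ne_top),
    mul_comm]
  exact h1

/-- Translates the index of a dyadic block into the iterated logarithm of its members; the factor 2
absorbs ln 2, since j ln 2 ≥ √j for large j. -/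
theorem eventually_half_log_le_log_log :
    ∀ᶠ j : ℕ in atTop, ∀ k : ℕ, 2 ^ j ≤ k → Real.log j ≤ 2 * Real.log (Real.log k) := by
  have h2 : (0 : ℝ) < Real.log 2 := Real.log_pos (by norm_num)
  have hev : ∀ᶠ j : ℕ in atTop, 1 / Real.log 2 ^ 2 ≤ (j : ℝ) :=
    tendsto_natCast_atTop_atTop.eventually_ge_atTop _
  filter_upwards [hev, eventually_gt_atTop 0] with j hj hj0 k hk
  have hj0' : (0 : ℝ) < j := by exact_mod_cast hj0
  have hlogk : j * Real.log 2 ≤ Real.log k := by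
    rw [← Real.log_pow]
    exact Real.log_le_log (by positivity) (by exact_mod_cast hk)
  have hpos : 0 < (j : ℝ) * Real.log 2 := by positivity
  have : Real.log j ≤ Real.log ((j * Real.log 2) ^ 2) := by
    refine Real.log_le_log hj0' ?_
    rw [div_le_iff₀ (by positivity)] at hj
    nlinarith
  rw [Real.log_pow] at this
  have h3 := Real.log_le_log hpos hlogk
  push_cast at this
  linarith

theorem ae_eventually_sum_le (hX : ∀ i, Measurable (X i)) (hind : iIndepFun X μ)
    (hB : 0 < B) (hb : ∀ i ω, |X i ω| ≤ B) (h0 : ∀ i, ∫ ω, X i ω ∂μ = 0) :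
    ∀ᵐ ω ∂μ, ∀ᶠ k : ℕ in atTop,
      ∑ i ∈ Finset.range k, X i ω ≤ 4 * B * √(k * Real.log (Real.log k)) := by
  -- This level makes exp(-a_j² / (2 · 2^(j+1) B²)) equal to j^(-2), which is summable for
  -- Borel–Cantelli.
  set a : ℕ → ℝ := fun j => 2 * B * √(2 ^ (j + 1) * Real.log j) with ha
  set A : ℕ → Set Ω := fun j =>
    {ω | ∃ k ≤ 2 ^ (j + 1) - 1, a j ≤ ∑ i ∈ Finset.range (k + 1), X i ω} with hA
  -- The shift avoids j = 0, where the right side would be 0 by the convention for division.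
  have hprob : ∀ j : ℕ, μ (A (j + 1)) ≤ ENNReal.ofReal (1 / ((j + 1 : ℕ) : ℝ) ^ 2) := by
    intro i
    set j := i + 1 with hj
    have hj1 : (1 : ℝ) ≤ j := by rw [hj]; push_cast; linarith [(Nat.cast_nonneg i : (0 : ℝ) ≤ i)]
    have hlog : 0 ≤ Real.log j := Real.log_nonneg hj1
    have hP : (0 : ℝ) < 2 ^ (j + 1) := by positivity
    have hcast : ((2 ^ (j + 1) - 1 : ℕ) : ℝ) + 1 = 2 ^ (j + 1) := by
      rw [Nat.cast_sub Nat.one_le_two_pow]; push_cast; ring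
    have ha0 : 0 ≤ a j := by positivity
    have hasq : a j ^ 2 = 4 * B ^ 2 * (2 ^ (j + 1) * Real.log j) := by
      rw [ha]; simp only [mul_pow]
      rw [Real.sq_sqrt (by positivity)]; ring
    refine (measure_exists_sum_ge_le hX hind hb h0
      -- The minimiser of the exponent -t a + 2^(j+1) B² t² / 2.
      (t := a j / (2 ^ (j + 1) * B ^ 2)) (by positivity) (a j) _).trans ?_
    refine ENNReal.ofReal_le_ofReal (le_of_eq ?_)
    rw [hcast]
    have : -(a j / (2 ^ (j + 1) * B ^ 2) * a j) +
        2 ^ (j + 1) * B ^ 2 * (a j / (2 ^ (j + 1) * B ^ 2)) ^ 2 / 2 =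
        -(a j ^ 2 / (2 * (2 ^ (j + 1) * B ^ 2))) := by
      field_simp; ring
    rw [this, hasq]
    have : 4 * B ^ 2 * (2 ^ (j + 1) * Real.log j) / (2 * (2 ^ (j + 1) * B ^ 2)) =
        Real.log ((j : ℝ) ^ 2) := by
      rw [Real.log_pow]; field_simp; push_cast; ring
    rw [this, Real.exp_neg, Real.exp_log (by positivity), one_div]
  have hsum : ∑' j, μ (A (j + 1)) ≠ ⊤ := by
    refine ne_top_of_le_ne_top ?_ (ENNReal.tsum_le_tsum hprob)
    have hs : Summable fun j : ℕ => 1 / ((j + 1 : ℕ) : ℝ) ^ 2 :=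
      (summable_nat_add_iff 1).2 (Real.summable_one_div_nat_pow.2 (by norm_num : 1 < 2))
    exact hs.tsum_ofReal_ne_top
  filter_upwards [ae_eventually_notMem hsum] with ω hω
  obtain ⟨J, hJ⟩ := eventually_atTop.1 (hω.and
    ((tendsto_add_atTop_nat 1).eventually eventually_half_log_le_log_log))
  refine eventually_atTop.2 ⟨2 ^ (J + 1), fun k hk => ?_⟩
  set j := Nat.log 2 k with hj
  have hk0 : k ≠ 0 := by have := Nat.one_le_two_pow (n := J + 1); omega
  have hjle : 2 ^ j ≤ k := Nat.pow_log_le_self 2 hk0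
  have hjlt : k < 2 ^ (j + 1) := Nat.lt_pow_succ_log_self (by norm_num) k
  have hJj : J + 1 ≤ j := (Nat.le_log_iff_pow_le (by norm_num) hk0).2 hk
  obtain ⟨h1, h2⟩ := hJ (j - 1) (by omega)
  rw [Nat.sub_add_cancel (by omega)] at h1 h2
  have h3 : ∑ i ∈ Finset.range k, X i ω < a j := by
    by_contra! hc
    refine h1 ⟨k - 1, by omega, ?_⟩
    rwa [Nat.sub_add_cancel (by omega)]
  refine h3.le.trans ?_
  have hlog : 0 ≤ Real.log j := Real.log_natCast_nonneg j
  have hkk : (2 : ℝ) ^ j ≤ k := by exact_mod_cast hjle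
  calc a j ≤ 2 * B * √(2 ^ 2 * (k * Real.log (Real.log k))) := by
        refine mul_le_mul_of_nonneg_left (Real.sqrt_le_sqrt ?_) (by positivity)
        have := h2 k hjle
        calc (2 : ℝ) ^ (j + 1) * Real.log j = 2 * (2 ^ j * Real.log j) := by ring
          _ ≤ 2 * (k * (2 * Real.log (Real.log k))) := by gcongr
          _ = _ := by ring
    _ = _ := by rw [Real.sqrt_mul (by norm_num), Real.sqrt_sq (by norm_num)]; ring

/-- The upper half of the law of the iterated logarithm for bounded independent centred variables,
with a non-optimal constant. -/
theorem ae_sum_isBigO_sqrt_mul_log_log (hX : ∀ i, Measurable (X i)) (hind : iIndepFun X μ)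
    (hb : ∀ i ω, |X i ω| ≤ B) (h0 : ∀ i, ∫ ω, X i ω ∂μ = 0) :
    ∀ᵐ ω ∂μ, (fun k : ℕ => ∑ i ∈ Finset.range k, X i ω) =O[atTop]
      fun k : ℕ => √(k * Real.log (Real.log k)) := by
  have hb' : ∀ i ω, |X i ω| ≤ |B| + 1 := fun i ω => (hb i ω).trans
    ((le_abs_self B).trans (by linarith))
  have hneg : iIndepFun (fun i ω => -X i ω) μ :=
    hind.comp (fun _ x => -x) fun _ => measurable_neg
  have hB : 0 < |B| + 1 := by positivity
  filter_upwards [ae_eventually_sum_le hX hind hB hb' h0,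
    ae_eventually_sum_le (X := fun i ω => -X i ω) (fun i => (hX i).neg) hneg hB
      (fun i ω => by rw [abs_neg]; exact hb' i ω)
      (fun i => by rw [integral_neg, h0, neg_zero])] with ω h1 h2
  refine IsBigO.of_bound (4 * (|B| + 1)) ?_
  filter_upwards [h1, h2] with k hk1 hk2
  rw [Real.norm_eq_abs, Real.norm_eq_abs, abs_of_nonneg (Real.sqrt_nonneg _), abs_le]
  rw [Finset.sum_neg_distrib] at hk2
  constructor <;> linarith

end LIL

/-! ### Contraction of rank-one recursions under persistent excitation -/

section LinearRecursion

variable {E : Type*} [NormedAddCommGroup E] [InnerProductSpace ℝ E]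

theorem norm_sq_sub_inner_smul (b : ℝ) (p v : E) :
    ‖v - (b * inner ℝ p v) • p‖ ^ 2 =
      ‖v‖ ^ 2 - (2 * b - b ^ 2 * ‖p‖ ^ 2) * (inner ℝ p v) ^ 2 := by
  rw [norm_sub_sq_real, inner_smul_right, real_inner_comm, norm_smul, mul_pow, Real.norm_eq_abs,
    sq_abs]
  ring

theorem norm_sub_inner_smul_le {b : ℝ} {p : E} (hb : 0 ≤ b) (hbp : b * ‖p‖ ^ 2 ≤ 1) (v : E) :
    ‖v - (b * inner ℝ p v) • p‖ ≤ ‖v‖ := by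
  refine le_of_sq_le_sq ?_ (norm_nonneg _)
  rw [norm_sq_sub_inner_smul]
  have : 0 ≤ b * (2 - b * ‖p‖ ^ 2) * (inner ℝ p v) ^ 2 := by
    have : 0 ≤ 2 - b * ‖p‖ ^ 2 := by linarith
    positivity
  nlinarith

/-- Contraction of the homogeneous recursion over one window of excitation. -/
theorem norm_window_le {p : ℕ → E} {b : ℕ → ℝ} {h : ℕ → E} {M l u κ : ℝ} {N : ℕ}
    (hM : 0 ≤ M) (hp : ∀ j < N, ‖p j‖ ≤ M) (hl : 0 ≤ l) (hlb : ∀ j < N, l ≤ b j)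
    (hbu : ∀ j < N, b j ≤ u) (hlu : l ≤ u) (huM : u * M ^ 2 ≤ 1)
    (hexc : κ * ‖h 0‖ ^ 2 ≤ ∑ j ∈ Finset.range N, (inner ℝ (p j) (h 0)) ^ 2)
    (hrec : ∀ j < N, h (j + 1) = h j - (b j * inner ℝ (p j) (h j)) • p j) :
    ‖h N‖ ≤ Real.exp (-(l * κ) + (4 * N ^ 2 + N) * M ^ 4 / 2 * u ^ 2) * ‖h 0‖ := by
  have hu : 0 ≤ u := hl.trans hlu
  have hbp : ∀ j < N, b j * ‖p j‖ ^ 2 ≤ 1 := fun j hj =>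
    (mul_le_mul (hbu j hj) (pow_le_pow_left₀ (norm_nonneg _) (hp j hj) 2) (by positivity) hu).trans
      huM
  have hle : ∀ j ≤ N, ‖h j‖ ≤ ‖h 0‖ := by
    intro j
    induction j with
    | zero => intro _; rfl
    | succ j ih =>
      intro hj
      rw [hrec j hj]
      exact (norm_sub_inner_smul_le (hl.trans (hlb j hj)) (hbp j hj) _).trans (ih (by omega))
  have hinner : ∀ j < N, ∀ v, |inner ℝ (p j) v| ≤ M * ‖v‖ := fun j hj v =>
    (abs_real_inner_le_norm _ _).trans (mul_le_mul_of_nonneg_right (hp j hj) (norm_nonneg _))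
  have hdiff : ∀ j ≤ N, ‖h j - h 0‖ ≤ j * (u * M ^ 2 * ‖h 0‖) := by
    intro j
    induction j with
    | zero => intro _; simp
    | succ j ih =>
      intro hj
      have h1 : h (j + 1) - h 0 = (h j - h 0) - (b j * inner ℝ (p j) (h j)) • p j := by
        rw [hrec j hj]; abel
      rw [h1]
      refine (norm_sub_le _ _).trans ?_
      have h2 : ‖(b j * inner ℝ (p j) (h j)) • p j‖ ≤ u * M ^ 2 * ‖h 0‖ := by
        rw [norm_smul, norm_mul, Real.norm_eq_abs, Real.norm_eq_abs,
          abs_of_nonneg (hl.trans (hlb j hj))]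
        calc b j * |inner ℝ (p j) (h j)| * ‖p j‖ ≤ u * (M * ‖h 0‖) * M := by
              gcongr
              · exact hbu j hj
              · exact (hinner j hj _).trans (mul_le_mul_of_nonneg_left (hle j (by omega)) hM)
              · exact hp j hj
          _ = _ := by ring
      have := ih (by omega)
      push_cast
      linarith
  -- Freezing the state at the start of the window changes each squared inner product by first order
  -- in u only, because the state moves by at most N u M² ‖h 0‖.
  set c : ℝ := 2 * N * M ^ 4 * u with hc
  have hsq : ∀ j < N, (inner ℝ (p j) (h 0)) ^ 2 - c * ‖h 0‖ ^ 2 ≤ (inner ℝ (p j) (h j)) ^ 2 := by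
    intro j hj
    have h1 : inner ℝ (p j) (h j) = inner ℝ (p j) (h 0) + inner ℝ (p j) (h j - h 0) := by
      rw [← inner_add_right]; congr 1; abel
    have h2 : |inner ℝ (p j) (h j - h 0)| ≤ M * (N * (u * M ^ 2 * ‖h 0‖)) := by
      refine (hinner j hj _).trans (mul_le_mul_of_nonneg_left ((hdiff j hj.le).trans ?_) hM)
      have : (j : ℝ) ≤ N := by exact_mod_cast hj.le
      gcongr
    have h3 : |inner ℝ (p j) (h 0) * inner ℝ (p j) (h j - h 0)| ≤
        (M * ‖h 0‖) * (M * (N * (u * M ^ 2 * ‖h 0‖))) := by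
      rw [abs_mul]
      exact mul_le_mul (hinner j hj _) h2 (abs_nonneg _) (by positivity)
    have h4 := (abs_le.1 h3).1
    rw [h1, hc]
    nlinarith [sq_nonneg (inner ℝ (p j) (h j - h 0))]
  -- Sum of the exact one-step energy losses; the quadratic corrections b² ‖p‖² ⟪p, h⟫² are kept as
  -- a separate error of order u².
  have henergy : ∀ J ≤ N, ‖h J‖ ^ 2 ≤ ‖h 0‖ ^ 2 -
      2 * l * ∑ j ∈ Finset.range J, (inner ℝ (p j) (h j)) ^ 2 +
      J * (u ^ 2 * M ^ 4 * ‖h 0‖ ^ 2) := by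
    intro J
    induction J with
    | zero => intro _; simp
    | succ j ih =>
      intro hj
      have h1 := ih (by omega)
      have h2 := norm_sq_sub_inner_smul (b j) (p j) (h j)
      rw [← hrec j hj] at h2
      have h3 : b j ^ 2 * ‖p j‖ ^ 2 * (inner ℝ (p j) (h j)) ^ 2 ≤ u ^ 2 * M ^ 4 * ‖h 0‖ ^ 2 := by
        have h5 : (inner ℝ (p j) (h j)) ^ 2 ≤ (M * ‖h 0‖) ^ 2 := by
          rw [← sq_abs]
          refine pow_le_pow_left₀ (abs_nonneg _) ((hinner j hj _).trans ?_) 2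
          exact mul_le_mul_of_nonneg_left (hle j (by omega)) hM
        calc b j ^ 2 * ‖p j‖ ^ 2 * (inner ℝ (p j) (h j)) ^ 2
            ≤ u ^ 2 * M ^ 2 * (M * ‖h 0‖) ^ 2 := by
              gcongr
              · exact hl.trans (hlb j hj)
              · exact hbu j hj
              · exact hp j hj
          _ = _ := by ring
      have h4 : l * (inner ℝ (p j) (h j)) ^ 2 ≤ b j * (inner ℝ (p j) (h j)) ^ 2 :=
        mul_le_mul_of_nonneg_right (hlb j hj) (sq_nonneg _)
      rw [Finset.sum_range_succ]
      push_cast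
      linarith
  have hsum : κ * ‖h 0‖ ^ 2 - N * (c * ‖h 0‖ ^ 2) ≤
      ∑ j ∈ Finset.range N, (inner ℝ (p j) (h j)) ^ 2 := by
    have := Finset.sum_le_sum fun j (hj : j ∈ Finset.range N) => hsq j (Finset.mem_range.1 hj)
    rw [Finset.sum_sub_distrib, Finset.sum_const, Finset.card_range, nsmul_eq_mul] at this
    linarith
  have hfin : ‖h N‖ ^ 2 ≤
      (1 + 2 * (-(l * κ) + (4 * N ^ 2 + N) * M ^ 4 / 2 * u ^ 2)) * ‖h 0‖ ^ 2 := by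
    have h1 := henergy N le_rfl
    have h2 := mul_le_mul_of_nonneg_left hsum hl
    have h3 : l * (N * (c * ‖h 0‖ ^ 2)) ≤ u * (N * (c * ‖h 0‖ ^ 2)) :=
      mul_le_mul_of_nonneg_right hlu (by positivity)
    have h4 : u * (N * (c * ‖h 0‖ ^ 2)) = 2 * N ^ 2 * M ^ 4 * u ^ 2 * ‖h 0‖ ^ 2 := by
      rw [hc]; ring
    nlinarith
  refine le_of_sq_le_sq (hfin.trans ?_) (by positivity)
  rw [mul_pow, ← Real.exp_nat_mul]
  refine mul_le_mul_of_nonneg_right ?_ (by positivity)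
  push_cast
  linarith [Real.add_one_le_exp (2 * (-(l * κ) + (4 * (N : ℝ) ^ 2 + N) * M ^ 4 / 2 * u ^ 2))]

/-- The iterates of `v ↦ v - b j ⟪p j, v⟫ p j`. -/
noncomputable def homogeneousFlow (p : ℕ → E) (b : ℕ → ℝ) (v : E) : ℕ → E
  | 0 => v
  | j + 1 => homogeneousFlow p b v j -
      (b j * inner ℝ (p j) (homogeneousFlow p b v j)) • p j

/-- Every homogeneous step is linear and nonexpansive, so the perturbations add up without
amplification. -/
theorem norm_sub_homogeneousFlow_le {p z e : ℕ → E} {b : ℕ → ℝ} {N : ℕ}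
    (hb : ∀ j < N, 0 ≤ b j) (hbp : ∀ j < N, b j * ‖p j‖ ^ 2 ≤ 1)
    (hrec : ∀ j < N, z (j + 1) = z j - (b j * inner ℝ (p j) (z j)) • p j + e j) :
    ‖z N - homogeneousFlow p b (z 0) N‖ ≤ ∑ j ∈ Finset.range N, ‖e j‖ := by
  suffices h : ∀ J ≤ N, ‖z J - homogeneousFlow p b (z 0) J‖ ≤ ∑ j ∈ Finset.range J, ‖e j‖ from
    h N le_rfl
  intro J
  induction J with
  | zero => intro _; simp [homogeneousFlow]
  | succ j ih =>
    intro hj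
    set g := homogeneousFlow p b (z 0) j with hg
    have h1 : z (j + 1) - homogeneousFlow p b (z 0) (j + 1) =
        ((z j - g) - (b j * inner ℝ (p j) (z j - g)) • p j) + e j := by
      rw [hrec j hj, homogeneousFlow, ← hg, inner_sub_right, mul_sub, sub_smul]; abel
    rw [h1, Finset.sum_range_succ]
    exact (norm_add_le _ _).trans (add_le_add_left
      ((norm_sub_inner_smul_le (hb j hj) (hbp j hj) _).trans (ih (by omega))) _)

/-- Solutions of the perturbed recursion stay bounded under summable perturbations. -/
theorem exists_norm_le_of_summable {φ z e : ℕ → E} {a : ℕ → ℝ} {M A : ℝ}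
    (hφ : ∀ k, 1 ≤ k → ‖φ k‖ ≤ M) (ha0 : ∀ᶠ k in atTop, 0 ≤ a k) (haA : ∀ᶠ k in atTop, a k ≤ A)
    (hrec : ∀ᶠ k : ℕ in atTop, z (k + 1) = z k -
      (a (k + 1) / (k + 1 : ℕ) * inner ℝ (φ (k + 1)) (z k)) • φ (k + 1) + e (k + 1))
    (he : Summable fun k => ‖e k‖) : ∃ R, ∀ k, ‖z k‖ ≤ R := by
  have hbig : ∀ᶠ k : ℕ in atTop, |A| * M ^ 2 ≤ k :=
    tendsto_natCast_atTop_atTop.eventually_ge_atTop _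
  obtain ⟨m, hm⟩ := eventually_atTop.1 (ha0.and (haA.and (hrec.and hbig)))
  have hbound : ∀ k ≥ m, ‖z k‖ ≤ ‖z m‖ + ∑ i ∈ Finset.range (k + 1), ‖e i‖ := by
    intro k hk
    induction k, hk using Nat.le_induction with
    | base => exact le_add_of_nonneg_right (Finset.sum_nonneg fun _ _ => norm_nonneg _)
    | succ k hk ih =>
      obtain ⟨h0, hA, -, hB⟩ := hm (k + 1) (by omega)
      have hr := (hm k hk).2.2.1
      have hk1 : (0 : ℝ) < (k + 1 : ℕ) := by positivity
      have hn : a (k + 1) / (k + 1 : ℕ) * ‖φ (k + 1)‖ ^ 2 ≤ 1 := by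
        rw [div_mul_eq_mul_div, div_le_one hk1]
        refine le_trans ?_ hB
        exact mul_le_mul (hA.trans (le_abs_self _))
          (pow_le_pow_left₀ (norm_nonneg _) (hφ _ (by omega)) 2) (by positivity) (abs_nonneg _)
      rw [hr, Finset.sum_range_succ _ (k + 1), ← add_assoc]
      exact (norm_add_le _ _).trans (add_le_add_left
        ((norm_sub_inner_smul_le (by positivity) hn _).trans ih) _)
  refine ⟨(‖z m‖ + ∑' i, ‖e i‖) + ∑ k ∈ Finset.range m, ‖z k‖, fun k => ?_⟩
  have hts : 0 ≤ ∑' i, ‖e i‖ := tsum_nonneg fun _ => norm_nonneg _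
  rcases lt_or_ge k m with hk | hk
  · have := Finset.single_le_sum (f := fun k => ‖z k‖) (fun _ _ => norm_nonneg _)
      (Finset.mem_range.2 hk)
    have := norm_nonneg (z m)
    linarith
  · have h1 := hbound k hk
    have h2 := he.sum_le_tsum (Finset.range (k + 1)) fun _ _ => norm_nonneg _
    have h3 : 0 ≤ ∑ k ∈ Finset.range m, ‖z k‖ := Finset.sum_nonneg fun _ _ => norm_nonneg _
    linarith

/-- The weight k^(αδ) grows over a window at the same first-order rate as the flow contracts, so the
weighted norm gains only a factor exp(O(1/m²)). -/
theorem rpow_mul_norm_window_le {φ z e : ℕ → E} {a : ℕ → ℝ} {M A α δ : ℝ} {N : ℕ}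
    (hM : 0 ≤ M) (hφ : ∀ k, 1 ≤ k → ‖φ k‖ ≤ M) (hα : 0 < α) (hδ : 0 < δ) (hαA : α ≤ A)
    (hexc : ∀ k, 1 ≤ k → ∀ v,
      N * δ * ‖v‖ ^ 2 ≤ ∑ i ∈ Finset.range N, (inner ℝ (φ (k + i)) v) ^ 2)
    {m : ℕ} (hm : 1 ≤ m) (hmA : A * M ^ 2 ≤ m)
    (haα : ∀ k ≥ m, α ≤ a k) (haA : ∀ k ≥ m, a k ≤ A)
    (hrec : ∀ k ≥ m, z (k + 1) = z k -
      (a (k + 1) / (k + 1 : ℕ) * inner ℝ (φ (k + 1)) (z k)) • φ (k + 1) + e (k + 1)) :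
    ((m + N : ℕ) : ℝ) ^ (α * δ) * ‖z (m + N)‖ ≤
      Real.exp ((α * δ * N ^ 2 + (4 * N ^ 2 + N) * M ^ 4 / 2 * A ^ 2) * (1 / (m : ℝ) ^ 2)) *
        ((m : ℝ) ^ (α * δ) * ‖z m‖) +
      (1 + N : ℝ) ^ (α * δ) *
        ∑ j ∈ Finset.range N, ((m + 1 + j : ℕ) : ℝ) ^ (α * δ) * ‖e (m + 1 + j)‖ := by
  have hm0 : (0 : ℝ) < m := by exact_mod_cast hm
  have hmN : (0 : ℝ) < (m + N : ℕ) := by positivity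
  set p : ℕ → E := fun j => φ (m + 1 + j) with hp
  set b : ℕ → ℝ := fun j => a (m + 1 + j) / (m + 1 + j : ℕ) with hb
  have hA : 0 ≤ A := hα.le.trans hαA
  have hpM : ∀ j, ‖p j‖ ≤ M := fun j => hφ _ (by omega)
  have hlb : ∀ j < N, α / (m + N : ℕ) ≤ b j := by
    intro j hj
    have : ((m + 1 + j : ℕ) : ℝ) ≤ (m + N : ℕ) := by exact_mod_cast (by omega)
    exact div_le_div₀ (hα.le.trans (haα _ (by omega))) (haα _ (by omega))
      (by positivity) this
  have hbu : ∀ j < N, b j ≤ A / m := by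
    intro j hj
    have : (m : ℝ) ≤ (m + 1 + j : ℕ) := by exact_mod_cast (by omega)
    exact div_le_div₀ hA (haA _ (by omega)) hm0 this
  have huM : A / m * M ^ 2 ≤ 1 := by
    rw [div_mul_eq_mul_div, div_le_one hm0]; exact hmA
  have hlu : α / (m + N : ℕ) ≤ A / m :=
    div_le_div₀ hA hαA hm0 (by push_cast; linarith [(Nat.cast_nonneg N : (0 : ℝ) ≤ N)])
  have hl : 0 ≤ α / (m + N : ℕ) := by positivity
  have hhom := norm_window_le (h := homogeneousFlow p b (z m)) hM (fun j _ => hpM j) hl hlb hbu hlu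
    huM (κ := N * δ) (by simpa [homogeneousFlow, hp] using hexc (m + 1) (by omega) (z m))
    (fun j _ => rfl)
  have hcmp := norm_sub_homogeneousFlow_le (p := p) (b := b) (z := fun j => z (m + j))
    (e := fun j => e (m + 1 + j)) (N := N) (fun j hj => hl.trans (hlb j hj))
    (fun j hj => (mul_le_mul (hbu j hj) (pow_le_pow_left₀ (norm_nonneg _) (hpM j) 2)
      (by positivity) (by positivity)).trans huM)
    (fun j hj => by
      have h1 := hrec (m + j) (by omega)
      have h2 : m + 1 + j = m + j + 1 := by omega
      simp only [hp, hb, h2]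
      rw [← add_assoc]
      exact h1)
  simp only [add_zero] at hcmp
  set g := homogeneousFlow p b (z m) with hg
  have hg0 : g 0 = z m := rfl
  have hz : ‖z (m + N)‖ ≤ ‖g N‖ + ∑ j ∈ Finset.range N, ‖e (m + 1 + j)‖ := by
    have : ‖z (m + N)‖ ≤ ‖g N‖ + ‖z (m + N) - g N‖ := norm_le_insert' _ _
    linarith
  have hη : 0 < α * δ := by positivity
  have hweight : ((m + N : ℕ) : ℝ) ^ (α * δ) ≤
      (m : ℝ) ^ (α * δ) * Real.exp (α * δ * (N / m)) := by
    have h1 : ((m + N : ℕ) : ℝ) ≤ m * Real.exp (N / m) := by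
      have := Real.add_one_le_exp ((N : ℝ) / m)
      calc ((m + N : ℕ) : ℝ) = m * (N / m + 1) := by push_cast; field_simp; ring
        _ ≤ _ := by gcongr
    refine (Real.rpow_le_rpow hmN.le h1 hη.le).trans (le_of_eq ?_)
    rw [Real.mul_rpow hm0.le (Real.exp_pos _).le, ← Real.exp_mul]
    ring_nf
  -- The growth αδN/m and the decay αδN/(m+N) cancel up to αδN²/m².
  have hexp : α * δ * (N / m) + (-(α / (m + N : ℕ) * (N * δ)) +
      (4 * N ^ 2 + N) * M ^ 4 / 2 * (A / m) ^ 2) ≤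
      (α * δ * N ^ 2 + (4 * N ^ 2 + N) * M ^ 4 / 2 * A ^ 2) * (1 / (m : ℝ) ^ 2) := by
    have h1 : (N : ℝ) / m - N / (m + N : ℕ) ≤ N ^ 2 / (m : ℝ) ^ 2 := by
      have h2 : (N : ℝ) / m - N / (m + N : ℕ) = N ^ 2 / ((m : ℝ) * (m + N : ℕ)) := by
        field_simp; push_cast; ring
      rw [h2]
      have h3 : (m : ℝ) ≤ (m + N : ℕ) := by exact_mod_cast (by omega)
      rw [sq (m : ℝ)]
      gcongr
    have h4 := mul_le_mul_of_nonneg_left h1 hη.le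
    have h5 : α * δ * (N / m) + (-(α / (m + N : ℕ) * (N * δ)) +
      (4 * N ^ 2 + N) * M ^ 4 / 2 * (A / m) ^ 2) = α * δ * ((N : ℝ) / m - N / (m + N : ℕ)) +
      (4 * N ^ 2 + N) * M ^ 4 / 2 * A ^ 2 * (1 / (m : ℝ) ^ 2) := by
      field_simp
      ring
    rw [h5, add_mul]
    have h6 : α * δ * (N ^ 2 / (m : ℝ) ^ 2) = α * δ * N ^ 2 * (1 / (m : ℝ) ^ 2) := by ring
    linarith
  have herr : ∀ j ∈ Finset.range N, ((m + N : ℕ) : ℝ) ^ (α * δ) * ‖e (m + 1 + j)‖ ≤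
      (1 + N : ℝ) ^ (α * δ) * (((m + 1 + j : ℕ) : ℝ) ^ (α * δ) * ‖e (m + 1 + j)‖) := by
    intro j _
    rw [← mul_assoc, ← Real.mul_rpow (by positivity) (by positivity)]
    refine mul_le_mul_of_nonneg_right (Real.rpow_le_rpow hmN.le ?_ hη.le) (norm_nonneg _)
    push_cast
    nlinarith [mul_nonneg (Nat.cast_nonneg (α := ℝ) N) hm0.le,
      mul_nonneg (Nat.cast_nonneg (α := ℝ) N) (Nat.cast_nonneg (α := ℝ) j),
      (Nat.cast_nonneg j : (0 : ℝ) ≤ j)]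
  calc ((m + N : ℕ) : ℝ) ^ (α * δ) * ‖z (m + N)‖
      ≤ ((m + N : ℕ) : ℝ) ^ (α * δ) * (‖g N‖ + ∑ j ∈ Finset.range N, ‖e (m + 1 + j)‖) := by gcongr
    _ = ((m + N : ℕ) : ℝ) ^ (α * δ) * ‖g N‖ +
        ∑ j ∈ Finset.range N, ((m + N : ℕ) : ℝ) ^ (α * δ) * ‖e (m + 1 + j)‖ := by
      rw [mul_add, Finset.mul_sum]
    _ ≤ _ := by
      rw [Finset.mul_sum]
      refine add_le_add ?_ (Finset.sum_le_sum herr)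
      calc ((m + N : ℕ) : ℝ) ^ (α * δ) * ‖g N‖
          ≤ ((m : ℝ) ^ (α * δ) * Real.exp (α * δ * (N / m))) *
            (Real.exp (-(α / (m + N : ℕ) * (N * δ)) +
              (4 * N ^ 2 + N) * M ^ 4 / 2 * (A / m) ^ 2) * ‖z m‖) := by
            rw [← hg0]; gcongr
        _ = Real.exp (α * δ * (N / m) + (-(α / (m + N : ℕ) * (N * δ)) +
              (4 * N ^ 2 + N) * M ^ 4 / 2 * (A / m) ^ 2)) * ((m : ℝ) ^ (α * δ) * ‖z m‖) := by
            rw [Real.exp_add (α * δ * (N / m))]; ring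
        _ ≤ _ := by gcongr

/-- Decay of the perturbed recursion under persistent excitation. -/
theorem exists_rpow_mul_norm_le {φ z e : ℕ → E} {a : ℕ → ℝ} {M A α δ : ℝ} {N : ℕ}
    (hN : 0 < N) (hφ : ∀ k, 1 ≤ k → ‖φ k‖ ≤ M) (hα : 0 < α) (hδ : 0 < δ)
    (hexc : ∀ k, 1 ≤ k → ∀ v,
      N * δ * ‖v‖ ^ 2 ≤ ∑ i ∈ Finset.range N, (inner ℝ (φ (k + i)) v) ^ 2)
    (haα : ∀ᶠ k in atTop, α ≤ a k) (haA : ∀ᶠ k in atTop, a k ≤ A)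
    (hrec : ∀ᶠ k : ℕ in atTop, z (k + 1) = z k -
      (a (k + 1) / (k + 1 : ℕ) * inner ℝ (φ (k + 1)) (z k)) • φ (k + 1) + e (k + 1)) :
    ∃ D, 0 ≤ D ∧ ∀ᶠ k : ℕ in atTop, (k : ℝ) ^ (α * δ) * ‖z k‖ ≤
      D * (1 + ∑ i ∈ Finset.range (k + 1), (i : ℝ) ^ (α * δ) * ‖e i‖) := by
  have hM : 0 ≤ M := (norm_nonneg _).trans (hφ 1 le_rfl)
  have hαA : α ≤ A := by
    obtain ⟨k, h1, h2⟩ := (haα.and haA).exists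
    exact h1.trans h2
  have hbig : ∀ᶠ k : ℕ in atTop, A * M ^ 2 ≤ k :=
    tendsto_natCast_atTop_atTop.eventually_ge_atTop _
  obtain ⟨m₀, hm₀⟩ := eventually_atTop.1
    (haα.and (haA.and (hrec.and (hbig.and (eventually_ge_atTop 1)))))
  set η := α * δ with hη
  set c := α * δ * N ^ 2 + (4 * N ^ 2 + N) * M ^ 4 / 2 * A ^ 2 with hc
  have hc0 : 0 ≤ c := by positivity
  -- Accumulates the second-order factors of all windows at once; it stays bounded since ∑ 1/i²
  -- converges.
  set P : ℕ → ℝ := fun k => Real.exp (c * ∑ i ∈ Finset.range k, 1 / (i : ℝ) ^ 2) with hP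
  set G : ℕ → ℝ := fun k => ∑ i ∈ Finset.range (k + 1), (i : ℝ) ^ η * ‖e i‖ with hG
  set L : ℝ := (1 + N : ℝ) ^ η with hL
  set B : ℝ := ∑ k ∈ Finset.range (m₀ + N), (k : ℝ) ^ η * ‖z k‖ with hB
  have hG0 : ∀ k, 0 ≤ G k := fun k => Finset.sum_nonneg fun _ _ => by positivity
  have hL0 : 0 ≤ L := by positivity
  have hB0 : 0 ≤ B := Finset.sum_nonneg fun _ _ => by positivity
  have hP1 : ∀ k, 1 ≤ P k := fun k => Real.one_le_exp
    (mul_nonneg hc0 (Finset.sum_nonneg fun _ _ => by positivity))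
  -- Strong induction in jumps of N: the indices in the first window after m₀ are covered by B, and
  -- every later one goes back by a whole window.
  have key : ∀ k ≥ m₀, (k : ℝ) ^ η * ‖z k‖ ≤ P k * (B + L * G k) := by
    intro k
    induction k using Nat.strong_induction_on with
    | _ k ih =>
      intro hk
      rcases lt_or_ge k (m₀ + N) with hlt | hge
      · have h1 : (k : ℝ) ^ η * ‖z k‖ ≤ B :=
          Finset.single_le_sum (f := fun k : ℕ => (k : ℝ) ^ η * ‖z k‖)
            (fun _ _ => by positivity) (Finset.mem_range.2 hlt)
        have h2 : 0 ≤ L * G k := mul_nonneg hL0 (hG0 k)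
        nlinarith [hP1 k]
      · obtain ⟨m, rfl⟩ : ∃ m, k = m + N := ⟨k - N, by omega⟩
        have hm : m₀ ≤ m := by omega
        have h1 := rpow_mul_norm_window_le hM hφ hα hδ hαA hexc (hm₀ m hm).2.2.2.2
          (hm₀ m hm).2.2.2.1 (fun i hi => (hm₀ i (hm.trans hi)).1)
          (fun i hi => (hm₀ i (hm.trans hi)).2.1) (fun i hi => (hm₀ i (hm.trans hi)).2.2.1)
        rw [← hη, ← hc, ← hL] at h1
        refine h1.trans ?_
        have h2 := ih m (by omega) hm
        have hPm : Real.exp (c * (1 / (m : ℝ) ^ 2)) * P m ≤ P (m + N) := by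
          rw [hP]
          simp only
          rw [← Real.exp_add, ← mul_add, Real.exp_le_exp]
          refine mul_le_mul_of_nonneg_left ?_ hc0
          rw [add_comm, ← Finset.sum_range_succ]
          exact Finset.sum_le_sum_of_subset_of_nonneg
            (Finset.range_mono (by omega)) fun _ _ _ => by positivity
        have hGm : G (m + N) = G m +
            ∑ j ∈ Finset.range N, ((m + 1 + j : ℕ) : ℝ) ^ η * ‖e (m + 1 + j)‖ := by
          rw [hG]
          simp only
          rw [show m + N + 1 = (m + 1) + N by omega, Finset.sum_range_add]
        set W := ∑ j ∈ Finset.range N, ((m + 1 + j : ℕ) : ℝ) ^ η * ‖e (m + 1 + j)‖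
        have hW0 : 0 ≤ W := Finset.sum_nonneg fun _ _ => by positivity
        have hX0 : 0 ≤ B + L * G m := add_nonneg hB0 (mul_nonneg hL0 (hG0 m))
        calc Real.exp (c * (1 / (m : ℝ) ^ 2)) * ((m : ℝ) ^ η * ‖z m‖) + L * W
            ≤ Real.exp (c * (1 / (m : ℝ) ^ 2)) * (P m * (B + L * G m)) + L * W := by gcongr
          _ = (Real.exp (c * (1 / (m : ℝ) ^ 2)) * P m) * (B + L * G m) + L * W := by ring
          _ ≤ P (m + N) * (B + L * G m) + P (m + N) * (L * W) := by
            refine add_le_add (mul_le_mul_of_nonneg_right hPm hX0) ?_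
            exact le_mul_of_one_le_left (mul_nonneg hL0 hW0) (hP1 _)
          _ = P (m + N) * (B + L * G (m + N)) := by rw [hGm]; ring
  have hs : Summable fun i : ℕ => 1 / (i : ℝ) ^ 2 :=
    Real.summable_one_div_nat_pow.2 (by norm_num)
  refine ⟨Real.exp (c * ∑' i : ℕ, 1 / (i : ℝ) ^ 2) * (B + L), by positivity,
    eventually_atTop.2 ⟨m₀, fun k hk => (key k hk).trans ?_⟩⟩
  rw [mul_assoc]
  have h1 : P k ≤ Real.exp (c * ∑' i : ℕ, 1 / (i : ℝ) ^ 2) :=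
    Real.exp_le_exp.2 (mul_le_mul_of_nonneg_left
      (hs.sum_le_tsum _ fun _ _ => by positivity) hc0)
  have h2 := hG0 k
  refine mul_le_mul h1 ?_ (add_nonneg hB0 (mul_nonneg hL0 h2)) (Real.exp_pos _).le
  have : 0 ≤ B * G k := mul_nonneg hB0 h2
  change B + L * G k ≤ (B + L) * (1 + G k)
  linarith

end LinearRecursion

/-! ### Sums of powers and iterated logarithms -/

section Rates

theorem eventually_one_le_log_log : ∀ᶠ k : ℕ in atTop, 1 ≤ Real.log (Real.log (k : ℝ)) :=
  (Real.tendsto_log_atTop.comp (Real.tendsto_log_atTop.comp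
    tendsto_natCast_atTop_atTop)).eventually_ge_atTop 1

theorem log_log_le_log_log {i k : ℕ} (hi : 3 ≤ i) (hik : i ≤ k) :
    Real.log (Real.log (i : ℝ)) ≤ Real.log (Real.log (k : ℝ)) := by
  have hi' : (1 : ℝ) < i := by exact_mod_cast (by omega)
  exact Real.log_le_log (Real.log_pos hi')
    (Real.log_le_log (by linarith) (by exact_mod_cast hik))

theorem sqrt_log_log_isBigO_rpow {τ : ℝ} (hτ : 0 < τ) :
    (fun k : ℕ => √(Real.log (Real.log (k : ℝ)))) =O[atTop] fun k : ℕ => (k : ℝ) ^ τ := by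
  refine IsBigO.trans ?_
    ((isLittleO_log_rpow_atTop hτ).comp_tendsto tendsto_natCast_atTop_atTop).isBigO
  refine IsBigO.of_bound 1 ?_
  filter_upwards [eventually_one_le_log_log, eventually_gt_atTop 1] with k hk hk1
  have hlog : 0 < Real.log (k : ℝ) := Real.log_pos (by exact_mod_cast hk1)
  rw [one_mul, Real.norm_eq_abs, abs_of_nonneg (Real.sqrt_nonneg _)]
  refine le_trans ?_ (le_abs_self _)
  calc √(Real.log (Real.log (k : ℝ))) ≤ Real.log (Real.log (k : ℝ)) := by
        rw [Real.sqrt_le_left (by linarith)]; nlinarith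
    _ ≤ _ := Real.log_le_self hlog.le

theorem sqrt_log_log_div_isBigO_rpow {s : ℝ} (hs : s < 1 / 2) :
    (fun k : ℕ => √(Real.log (Real.log (k : ℝ)) / k)) =O[atTop] fun k : ℕ => 1 / (k : ℝ) ^ s := by
  have h := (sqrt_log_log_isBigO_rpow (sub_pos.2 hs)).mul
    (isBigO_refl (fun k : ℕ => (k : ℝ) ^ (-(1 / 2) : ℝ)) atTop)
  refine (h.congr' ?_ ?_)
  · filter_upwards [eventually_one_le_log_log] with k hk
    rw [Real.sqrt_div (by linarith), Real.sqrt_eq_rpow (k : ℝ), Real.rpow_neg (by positivity),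
      div_eq_mul_inv (√_)]
  · filter_upwards [eventually_gt_atTop 0] with k hk
    have hk' : (0 : ℝ) < k := by exact_mod_cast hk
    rw [← Real.rpow_add hk', one_div (_ ^ s), ← Real.rpow_neg hk'.le]
    congr 1; ring

theorem rpow_mul_sqrt_mul_log_log_div_sq {k : ℕ} (hk : 0 < k) (s : ℝ) :
    (k : ℝ) ^ s * (√(k * Real.log (Real.log k)) / (k : ℝ) ^ 2) =
      √(Real.log (Real.log k)) * (k : ℝ) ^ (s - 3 / 2) := by
  have hk' : (0 : ℝ) < k := by exact_mod_cast hk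
  rw [Real.sqrt_mul hk'.le, Real.sqrt_eq_rpow (k : ℝ), ← Real.rpow_natCast, mul_comm _ (√_),
    mul_div_assoc, ← Real.rpow_sub hk', mul_left_comm, ← Real.rpow_add hk']
  congr 2; push_cast; ring

theorem summable_rpow_mul_of_isBigO {u : ℕ → ℝ} {s : ℝ} (hs : s < 1 / 2)
    (hu : u =O[atTop] fun k : ℕ => √(k * Real.log (Real.log k)) / (k : ℝ) ^ 2) :
    Summable fun k : ℕ => (k : ℝ) ^ s * u k := by
  have h1 := (isBigO_refl (fun k : ℕ => (k : ℝ) ^ s) atTop).mul hu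
  -- Half of the spare exponent absorbs √(ln ln k); the other half leaves the series summable.
  have hτ : 0 < (1 / 2 - s) / 2 := by linarith
  have h2 := (sqrt_log_log_isBigO_rpow hτ).mul
    (isBigO_refl (fun k : ℕ => (k : ℝ) ^ (s - 3 / 2)) atTop)
  have h3 : (fun k : ℕ => (k : ℝ) ^ s * (√(k * Real.log (Real.log k)) / (k : ℝ) ^ 2)) =O[atTop]
      fun k : ℕ => (k : ℝ) ^ (-1 - (1 / 2 - s) / 2) := by
    refine h2.congr' ?_ ?_
    · filter_upwards [eventually_one_le_log_log, eventually_gt_atTop 0] with k hk hk0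
      rw [rpow_mul_sqrt_mul_log_log_div_sq hk0]
    · filter_upwards [eventually_gt_atTop 0] with k hk
      have hk' : (0 : ℝ) < k := by exact_mod_cast hk
      rw [← Real.rpow_add hk']
      congr 1; ring
  exact summable_of_isBigO_nat (Real.summable_nat_rpow.2 (by linarith)) (h1.trans h3)

/-- Telescoping: Bernoulli's inequality for exponents in (0, 1) gives k^s ≤ (k+1)^s - s (k+1)^(s-1).
-/
theorem sum_rpow_sub_one_le {s : ℝ} (hs : 0 < s) (hs1 : s < 1) (k : ℕ) :
    ∑ i ∈ Finset.range (k + 1), (i : ℝ) ^ (s - 1) ≤ (k : ℝ) ^ s / s := by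
  induction k with
  | zero => simp [Real.zero_rpow (by linarith : s - 1 ≠ 0), Real.zero_rpow hs.ne']
  | succ k ih =>
    rw [Finset.sum_range_succ]
    refine (add_le_add_left ih _).trans ?_
    have hk : (0 : ℝ) < (k + 1 : ℕ) := by positivity
    have h1 : (k : ℝ) = (k + 1 : ℕ) * (1 + -(1 / ((k + 1 : ℕ) : ℝ))) := by
      field_simp; push_cast; ring
    have hle1 : 1 / ((k + 1 : ℕ) : ℝ) ≤ 1 := by
      rw [div_le_one hk]; push_cast; linarith [(Nat.cast_nonneg k : (0 : ℝ) ≤ k)]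
    have h2 := rpow_one_add_le_one_add_mul_self (s := -(1 / ((k + 1 : ℕ) : ℝ))) (by linarith)
      hs.le hs1.le
    have h3 : (k : ℝ) ^ s ≤ ((k + 1 : ℕ) : ℝ) ^ s - s * ((k + 1 : ℕ) : ℝ) ^ (s - 1) := by
      calc (k : ℝ) ^ s = ((k + 1 : ℕ) : ℝ) ^ s * (1 + -(1 / ((k + 1 : ℕ) : ℝ))) ^ s := by
            conv_lhs => rw [h1]
            exact Real.mul_rpow hk.le (by linarith)
        _ ≤ ((k + 1 : ℕ) : ℝ) ^ s * (1 + s * -(1 / ((k + 1 : ℕ) : ℝ))) := by gcongr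
        _ = _ := by rw [Real.rpow_sub_one hk.ne']; field_simp; ring
    have h4 : (k : ℝ) ^ s / s ≤ (((k + 1 : ℕ) : ℝ) ^ s - s * ((k + 1 : ℕ) : ℝ) ^ (s - 1)) / s := by
      gcongr
    rw [sub_div, mul_div_cancel_left₀ _ hs.ne'] at h4
    linarith

theorem sum_rpow_neg_one_le (k : ℕ) :
    ∑ i ∈ Finset.range (k + 1), (i : ℝ) ^ (-1 : ℝ) ≤ 1 + Real.log k := by
  refine le_trans (le_of_eq ?_) (harmonic_le_one_add_log k)
  rw [Finset.sum_range_succ', harmonic]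
  push_cast
  simp [Real.rpow_neg_one]

/-- The iterated logarithm is monotone, so its value at the last index can be taken out of the sum;
it is at least 1 there, which lets it absorb the finitely many initial terms. -/
theorem exists_sum_rpow_mul_le {u : ℕ → ℝ} {s : ℝ} (hu0 : ∀ k, 0 ≤ u k)
    (hu : u =O[atTop] fun k : ℕ => √(k * Real.log (Real.log k)) / (k : ℝ) ^ 2) :
    ∃ c, 0 ≤ c ∧ ∀ᶠ k : ℕ in atTop, 1 + ∑ i ∈ Finset.range (k + 1), (i : ℝ) ^ s * u i ≤
      c * √(Real.log (Real.log k)) * (1 + ∑ i ∈ Finset.range (k + 1), (i : ℝ) ^ (s - 3 / 2)) := by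
  obtain ⟨c, hc0, hc⟩ := hu.exists_nonneg
  obtain ⟨k₀, hk₀⟩ := eventually_atTop.1 (hc.bound.and
    (eventually_one_le_log_log.and (eventually_ge_atTop 3)))
  set B := ∑ i ∈ Finset.range k₀, (i : ℝ) ^ s * u i with hB
  have hterm : ∀ i : ℕ, 0 ≤ (i : ℝ) ^ s * u i := fun i => mul_nonneg (by positivity) (hu0 i)
  have hB0 : 0 ≤ B := Finset.sum_nonneg fun i _ => by
    have := hu0 i
    positivity
  refine ⟨1 + B + c, by positivity, eventually_atTop.2 ⟨k₀, fun k hk => ?_⟩⟩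
  set Q := √(Real.log (Real.log (k : ℝ))) with hQ
  have hQ1 : 1 ≤ Q := by rw [hQ, Real.one_le_sqrt]; exact (hk₀ k hk).2.1
  have hpt : ∀ i ∈ Finset.range (k + 1), (i : ℝ) ^ s * u i ≤
      (if i ∈ Finset.range k₀ then (i : ℝ) ^ s * u i else 0) + c * Q * (i : ℝ) ^ (s - 3 / 2) := by
    intro i hi
    have hcq : 0 ≤ c * Q * (i : ℝ) ^ (s - 3 / 2) := by positivity
    split_ifs with h
    · linarith
    · rw [Finset.mem_range, not_lt] at h
      obtain ⟨h1, h2, h3⟩ := hk₀ i h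
      rw [Real.norm_eq_abs, Real.norm_eq_abs, abs_of_nonneg (hu0 i),
        abs_of_nonneg (by positivity)] at h1
      have hik : i ≤ k := by simpa [Nat.lt_succ_iff] using hi
      calc (i : ℝ) ^ s * u i
          ≤ (i : ℝ) ^ s * (c * (√(i * Real.log (Real.log i)) / (i : ℝ) ^ 2)) := by gcongr
        _ = c * ((i : ℝ) ^ s * (√(i * Real.log (Real.log i)) / (i : ℝ) ^ 2)) := by ring
        _ = c * √(Real.log (Real.log i)) * (i : ℝ) ^ (s - 3 / 2) := by
            rw [rpow_mul_sqrt_mul_log_log_div_sq (by omega)]; ring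
        _ ≤ c * Q * (i : ℝ) ^ (s - 3 / 2) := by
            gcongr
            exact Real.sqrt_le_sqrt (log_log_le_log_log h3 hik)
        _ ≤ _ := by linarith
  have h1 := Finset.sum_le_sum hpt
  rw [Finset.sum_add_distrib, ← Finset.sum_filter, ← Finset.mul_sum] at h1
  have h2 : ∑ i ∈ Finset.range (k + 1) with i ∈ Finset.range k₀, (i : ℝ) ^ s * u i ≤ B :=
    Finset.sum_le_sum_of_subset_of_nonneg (fun i hi => (Finset.mem_filter.1 hi).2)
      fun i _ _ => hterm i
  set T := ∑ i ∈ Finset.range (k + 1), (i : ℝ) ^ (s - 3 / 2) with hT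
  have hT0 : 0 ≤ T := Finset.sum_nonneg fun _ _ => by positivity
  have h3 : 1 + B ≤ (1 + B) * (Q * (1 + T)) :=
    le_mul_of_one_le_right (by positivity) (by nlinarith)
  have h4 : c * Q * T ≤ c * Q * (1 + T) := by gcongr; linarith
  calc _ ≤ 1 + (B + c * Q * T) := by linarith
    _ ≤ (1 + B) * (Q * (1 + T)) + c * Q * (1 + T) := by linarith
    _ = _ := by ring

end Rates

/-! ### Decay rates below, at and above the critical exponent 1/2 -/

section Decay

variable {E : Type*} [NormedAddCommGroup E] [InnerProductSpace ℝ E]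
  {φ z e : ℕ → E} {a : ℕ → ℝ} {M A α δ : ℝ} {N : ℕ}

theorem isBigO_rpow_of_summable
    (hN : 0 < N) (hφ : ∀ k, 1 ≤ k → ‖φ k‖ ≤ M) (hα : 0 < α) (hδ : 0 < δ)
    (hexc : ∀ k, 1 ≤ k → ∀ v,
      N * δ * ‖v‖ ^ 2 ≤ ∑ i ∈ Finset.range N, (inner ℝ (φ (k + i)) v) ^ 2)
    (haα : ∀ᶠ k in atTop, α ≤ a k) (haA : ∀ᶠ k in atTop, a k ≤ A)
    (hrec : ∀ᶠ k : ℕ in atTop, z (k + 1) = z k -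
      (a (k + 1) / (k + 1 : ℕ) * inner ℝ (φ (k + 1)) (z k)) • φ (k + 1) + e (k + 1))
    (he : Summable fun k : ℕ => (k : ℝ) ^ (α * δ) * ‖e k‖) :
    z =O[atTop] fun k : ℕ => 1 / (k : ℝ) ^ (α * δ) := by
  obtain ⟨D, hD0, hD⟩ := exists_rpow_mul_norm_le hN hφ hα hδ hexc haα haA hrec
  refine IsBigO.of_bound (D * (1 + ∑' k : ℕ, (k : ℝ) ^ (α * δ) * ‖e k‖)) ?_
  filter_upwards [hD, eventually_gt_atTop 0] with k hk hk0
  have hk' : (0 : ℝ) < k := by exact_mod_cast hk0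
  have h1 := he.sum_le_tsum (Finset.range (k + 1)) fun _ _ => by positivity
  rw [Real.norm_eq_abs, abs_of_nonneg (by positivity), mul_one_div, le_div_iff₀ (by positivity),
    mul_comm]
  exact hk.trans (mul_le_mul_of_nonneg_left (by linarith) hD0)

theorem isBigO_log_mul_sqrt
    (hN : 0 < N) (hφ : ∀ k, 1 ≤ k → ‖φ k‖ ≤ M) (hα : 0 < α) (hδ : 0 < δ)
    (hexc : ∀ k, 1 ≤ k → ∀ v,
      N * δ * ‖v‖ ^ 2 ≤ ∑ i ∈ Finset.range N, (inner ℝ (φ (k + i)) v) ^ 2)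
    (haα : ∀ᶠ k in atTop, α ≤ a k) (haA : ∀ᶠ k in atTop, a k ≤ A)
    (hrec : ∀ᶠ k : ℕ in atTop, z (k + 1) = z k -
      (a (k + 1) / (k + 1 : ℕ) * inner ℝ (φ (k + 1)) (z k)) • φ (k + 1) + e (k + 1))
    (he : (fun k => ‖e k‖) =O[atTop] fun k : ℕ => √(k * Real.log (Real.log k)) / (k : ℝ) ^ 2)
    (hη : α * δ = 1 / 2) :
    z =O[atTop] fun k : ℕ => Real.log k * √(Real.log (Real.log k) / k) := by
  obtain ⟨D, hD0, hD⟩ := exists_rpow_mul_norm_le hN hφ hα hδ hexc haα haA hrec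
  obtain ⟨c, hc0, hc⟩ := exists_sum_rpow_mul_le (s := α * δ) (fun k => norm_nonneg (e k)) he
  refine IsBigO.of_bound (D * (c * 3)) ?_
  have hlog1 : ∀ᶠ k : ℕ in atTop, 2 ≤ Real.log (k : ℝ) :=
    (Real.tendsto_log_atTop.comp tendsto_natCast_atTop_atTop).eventually_ge_atTop 2
  filter_upwards [hD, hc, eventually_gt_atTop 0, eventually_one_le_log_log, hlog1]
    with k hk hck hk0 hll hlk
  have hk' : (0 : ℝ) < k := by exact_mod_cast hk0
  have hs := sum_rpow_neg_one_le k
  rw [hη] at hk hck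
  rw [show (1 / 2 - 3 / 2 : ℝ) = -1 by norm_num] at hck
  rw [Real.norm_eq_abs, abs_of_nonneg (by positivity), Real.sqrt_div (by linarith),
    Real.sqrt_eq_rpow (k : ℝ), ← mul_div_assoc, ← mul_div_assoc, le_div_iff₀ (by positivity),
    mul_comm]
  refine hk.trans ?_
  rw [mul_assoc]
  refine mul_le_mul_of_nonneg_left (hck.trans ?_) hD0
  calc c * √(Real.log (Real.log k)) * (1 + ∑ i ∈ Finset.range (k + 1), (i : ℝ) ^ (-1 : ℝ))
      ≤ c * √(Real.log (Real.log k)) * (3 * Real.log k) := by gcongr; linarith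
    _ = _ := by ring

theorem isBigO_sqrt
    (hN : 0 < N) (hφ : ∀ k, 1 ≤ k → ‖φ k‖ ≤ M) (hα : 0 < α) (hδ : 0 < δ)
    (hexc : ∀ k, 1 ≤ k → ∀ v,
      N * δ * ‖v‖ ^ 2 ≤ ∑ i ∈ Finset.range N, (inner ℝ (φ (k + i)) v) ^ 2)
    (haα : ∀ᶠ k in atTop, α ≤ a k) (haA : ∀ᶠ k in atTop, a k ≤ A)
    (hrec : ∀ᶠ k : ℕ in atTop, z (k + 1) = z k -
      (a (k + 1) / (k + 1 : ℕ) * inner ℝ (φ (k + 1)) (z k)) • φ (k + 1) + e (k + 1))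
    (he : (fun k => ‖e k‖) =O[atTop] fun k : ℕ => √(k * Real.log (Real.log k)) / (k : ℝ) ^ 2)
    (hη : 1 / 2 < α * δ) (hη1 : α * δ ≤ 1) :
    z =O[atTop] fun k : ℕ => √(Real.log (Real.log k) / k) := by
  obtain ⟨D, hD0, hD⟩ := exists_rpow_mul_norm_le hN hφ hα hδ hexc haα haA hrec
  obtain ⟨c, hc0, hc⟩ := exists_sum_rpow_mul_le (s := α * δ) (fun k => norm_nonneg (e k)) he
  set s := α * δ - 1 / 2 with hs
  have hs0 : 0 < s := by linarith
  refine IsBigO.of_bound (D * (c * (1 + 1 / s))) ?_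
  filter_upwards [hD, hc, eventually_gt_atTop 0, eventually_one_le_log_log]
    with k hk hck hk0 hll
  have hk' : (0 : ℝ) < k := by exact_mod_cast hk0
  have hk1 : (1 : ℝ) ≤ k := by exact_mod_cast hk0
  have hsum := sum_rpow_sub_one_le hs0 (by linarith) k
  have hks : 1 ≤ (k : ℝ) ^ s := Real.one_le_rpow hk1 hs0.le
  rw [show α * δ - 3 / 2 = s - 1 by rw [hs]; ring] at hck
  rw [show α * δ = s + 1 / 2 by rw [hs]; ring] at hk hck
  rw [Real.norm_eq_abs, abs_of_nonneg (by positivity), Real.sqrt_div (by linarith),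
    Real.sqrt_eq_rpow (k : ℝ), ← mul_div_assoc, le_div_iff₀ (by positivity), mul_comm]
  rw [Real.rpow_add hk'] at hk
  refine le_of_mul_le_mul_left ?_ (zero_lt_one.trans_le hks)
  rw [← mul_assoc]
  refine hk.trans ?_
  calc D * (1 + ∑ i ∈ Finset.range (k + 1), (i : ℝ) ^ (s + 1 / 2) * ‖e i‖)
      ≤ D * (c * √(Real.log (Real.log k)) * (1 + ∑ i ∈ Finset.range (k + 1), (i : ℝ) ^ (s - 1))) :=
        mul_le_mul_of_nonneg_left hck hD0
    _ ≤ D * (c * √(Real.log (Real.log k)) * ((k : ℝ) ^ s * (1 + 1 / s))) := by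
        gcongr
        rw [mul_add, mul_one, mul_one_div]
        linarith
    _ = _ := by ring

end Decay

/-! ### The error recursion: noise removal, consistency and rates -/

section ErrorRecursion

variable {E : Type*} [NormedAddCommGroup E] [InnerProductSpace ℝ E]

/-- A path `x` of the error recursion with state-dependent gains `a`, driven by noise `w` whose
weighted sums obey the bound of the law of the iterated logarithm. While the error is at most `r`
the gains are at least `I r`, and `I r` increases to `lam` as `r` decreases to `0`. -/
structure ErrorRecursion (φ x : ℕ → E) (a w : ℕ → ℝ) (I : ℝ → ℝ) (M A δ β lam : ℝ) (N : ℕ) :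
    Prop where
  window_pos : 0 < N
  bounded : ∀ k, 1 ≤ k → ‖φ k‖ ≤ M
  delta_pos : 0 < δ
  exciting : ∀ k, 1 ≤ k → ∀ v,
    N * δ * ‖v‖ ^ 2 ≤ ∑ i ∈ Finset.range N, (inner ℝ (φ (k + i)) v) ^ 2
  step : ∀ k, x (k + 1) = x k - (a (k + 1) / (k + 1 : ℕ) * inner ℝ (φ (k + 1)) (x k)) • φ (k + 1) +
    (β / (k + 1 : ℕ) * w (k + 1)) • φ (k + 1)
  noise : (fun k => ∑ i ∈ Finset.range k, w (i + 1) • φ (i + 1)) =O[atTop]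
    fun k : ℕ => √(k * Real.log (Real.log k))
  gain_le : ∀ k, 1 ≤ k → a k ≤ A
  le_gain : ∀ k r, 0 < r → ‖x k‖ ≤ r → I r ≤ a (k + 1)
  lower_pos : ∀ r, 0 < r → 0 < I r
  tendsto_lower : Tendsto I (𝓝[>] 0) (𝓝 lam)
  lower_le : ∀ r, 0 < r → I r ≤ lam

theorem isBigO_of_succ {F G : Type*} [Norm F] [Norm G] {u : ℕ → F} {v : ℕ → G}
    (h : (fun k => u (k + 1)) =O[atTop] fun k => v (k + 1)) : u =O[atTop] v := by
  rw [← map_add_atTop_eq_nat 1, isBigO_map]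
  exact h

theorem sqrt_mul_log_log_div_isBigO_succ :
    (fun k : ℕ => √(k * Real.log (Real.log k)) / ((k : ℝ) * (k + 1 : ℕ))) =O[atTop]
      fun k : ℕ => √((k + 1 : ℕ) * Real.log (Real.log ((k + 1 : ℕ) : ℝ))) /
        ((k + 1 : ℕ) : ℝ) ^ 2 := by
  refine IsBigO.of_bound 2 ?_
  filter_upwards [eventually_one_le_log_log, eventually_ge_atTop 3] with k hk hk3
  have hk' : (0 : ℝ) < k := by exact_mod_cast (by omega)
  have h1 := log_log_le_log_log hk3 (Nat.le_succ k)
  have hk2 : ((k + 1 : ℕ) : ℝ) ≤ 2 * k := by exact_mod_cast (by omega)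
  have hkk : (k : ℝ) ≤ (k + 1 : ℕ) := by exact_mod_cast (by omega)
  rw [Real.norm_eq_abs, Real.norm_eq_abs, abs_of_nonneg (by positivity),
    abs_of_nonneg (by positivity), ← mul_div_assoc, div_le_div_iff₀ (by positivity) (by positivity)]
  have h2 : √(k * Real.log (Real.log k)) ≤
      √((k + 1 : ℕ) * Real.log (Real.log ((k + 1 : ℕ) : ℝ))) := by
    refine Real.sqrt_le_sqrt ?_
    exact mul_le_mul hkk h1 (by linarith) (by positivity)
  calc √(k * Real.log (Real.log k)) * ((k + 1 : ℕ) : ℝ) ^ 2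
      ≤ √((k + 1 : ℕ) * Real.log (Real.log ((k + 1 : ℕ) : ℝ))) *
        ((2 * k) * (k + 1 : ℕ)) := by
        rw [sq]; gcongr
    _ = _ := by ring

theorem sqrt_mul_log_log_div_eq {k : ℕ} (hk : 0 < k) :
    √(k * Real.log (Real.log k)) / k = √(Real.log (Real.log k) / k) := by
  have hk' : (0 : ℝ) < k := by exact_mod_cast hk
  rw [div_eq_iff hk'.ne']
  conv_rhs => rw [← Real.sqrt_sq hk'.le]
  rw [← Real.sqrt_mul' _ (by positivity)]
  congr 1
  rw [Real.sqrt_sq hk'.le]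
  field_simp

theorem one_div_rpow_isBigO_of_le {s t : ℝ} (h : s ≤ t) :
    (fun k : ℕ => 1 / (k : ℝ) ^ t) =O[atTop] fun k : ℕ => 1 / (k : ℝ) ^ s := by
  refine IsBigO.of_bound 1 ?_
  filter_upwards [eventually_gt_atTop 0] with k hk
  have hk1 : (1 : ℝ) ≤ k := by exact_mod_cast hk
  rw [one_mul, Real.norm_eq_abs, Real.norm_eq_abs, abs_of_nonneg (by positivity),
    abs_of_nonneg (by positivity)]
  exact one_div_le_one_div_of_le (by positivity) (Real.rpow_le_rpow_of_exponent_le hk1 h)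

theorem tendsto_one_div_rpow {s : ℝ} (hs : 0 < s) :
    Tendsto (fun k : ℕ => 1 / (k : ℝ) ^ s) atTop (𝓝 0) := by
  simp only [one_div]
  exact ((tendsto_rpow_atTop hs).comp tendsto_natCast_atTop_atTop).inv_tendsto_atTop

namespace ErrorRecursion

variable {φ x : ℕ → E} {a w : ℕ → ℝ} {I : ℝ → ℝ} {M A δ β lam : ℝ} {N : ℕ}

theorem gain_pos (h : ErrorRecursion φ x a w I M A δ β lam N) {k : ℕ} (hk : 1 ≤ k) : 0 < a k := by
  obtain ⟨k, rfl⟩ : ∃ j, k = j + 1 := ⟨k - 1, by omega⟩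
  have hr : 0 < ‖x k‖ + 1 := by positivity
  exact (h.lower_pos _ hr).trans_le (h.le_gain k _ hr (by linarith))

theorem limit_pos (h : ErrorRecursion φ x a w I M A δ β lam N) : 0 < lam :=
  (h.lower_pos 1 one_pos).trans_le (h.lower_le 1 one_pos)

/-- Subtracting the averaged noise leaves a recursion with small perturbations. -/
theorem exists_shift (h : ErrorRecursion φ x a w I M A δ β lam N) :
    ∃ z e : ℕ → E,
      (∀ k : ℕ, z (k + 1) = z k -
        (a (k + 1) / (k + 1 : ℕ) * inner ℝ (φ (k + 1)) (z k)) • φ (k + 1) + e (k + 1)) ∧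
      ((fun k => ‖e k‖) =O[atTop] fun k : ℕ => √(k * Real.log (Real.log k)) / (k : ℝ) ^ 2) ∧
      ((fun k => x k - z k) =O[atTop] fun k : ℕ => √(Real.log (Real.log k) / k)) := by
  set S : ℕ → E := fun k => ∑ i ∈ Finset.range k, w (i + 1) • φ (i + 1) with hS
  set z : ℕ → E := fun k => x k - (β / k) • S k with hz
  -- Defined as the defect of the recursion, so that the recursion holds trivially and only the size
  -- of e needs proof.
  set e : ℕ → E := fun k => z k - (z (k - 1) -
    (a k / k * inner ℝ (φ k) (z (k - 1))) • φ k) with he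
  have hM : 0 ≤ M := (norm_nonneg _).trans (h.bounded 1 le_rfl)
  refine ⟨z, e, fun k => by simp [he], ?_, ?_⟩
  · refine isBigO_of_succ (IsBigO.trans ?_ sqrt_mul_log_log_div_isBigO_succ)
    have h1 : (fun k : ℕ => ‖e (k + 1)‖) =O[atTop]
        fun k : ℕ => ‖S k‖ / ((k : ℝ) * (k + 1 : ℕ)) := by
      refine IsBigO.of_bound (|β| * (1 + A * M ^ 2)) ?_
      filter_upwards [eventually_gt_atTop 0] with k hk
      have hk' : (0 : ℝ) < k := by exact_mod_cast hk
      have hk1 : (0 : ℝ) < (k + 1 : ℕ) := by positivity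
      -- Summation by parts: the fresh noise cancels, leaving S_k with the coefficient β/k -
      -- β/(k+1), and the gain applied to the shift.
      have hek : e (k + 1) = (β / (k * (k + 1 : ℕ))) • S k -
          (a (k + 1) / (k + 1 : ℕ) * inner ℝ (φ (k + 1)) ((β / k) • S k)) • φ (k + 1) := by
        have hSk : S (k + 1) = S k + w (k + 1) • φ (k + 1) := Finset.sum_range_succ _ _
        have hcoef : β / (k * (k + 1 : ℕ)) = β / k - β / (k + 1 : ℕ) := by
          field_simp; push_cast; ring
        simp only [he, hz, Nat.add_sub_cancel]
        rw [hSk, h.step k, hcoef, inner_sub_right]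
        module
      have hA : 0 ≤ A := (h.gain_pos le_rfl).le.trans (h.gain_le 1 le_rfl)
      rw [norm_norm, hek, Real.norm_eq_abs,
        abs_of_nonneg (a := ‖S k‖ / ((k : ℝ) * (k + 1 : ℕ))) (by positivity)]
      refine (norm_sub_le _ _).trans ?_
      rw [norm_smul, norm_smul, inner_smul_right, Real.norm_eq_abs, Real.norm_eq_abs, abs_mul,
        abs_mul, abs_div, abs_div, abs_div, abs_of_pos hk1, abs_of_pos hk',
        abs_of_pos (h.gain_pos (k := k + 1) (by omega)), abs_of_pos (mul_pos hk' hk1)]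
      have h2 : |inner ℝ (φ (k + 1)) (S k)| ≤ M * ‖S k‖ :=
        (abs_real_inner_le_norm _ _).trans
          (mul_le_mul_of_nonneg_right (h.bounded _ (by omega)) (norm_nonneg _))
      have h3 : a (k + 1) / (k + 1 : ℕ) * (|β| / k * |inner ℝ (φ (k + 1)) (S k)|) *
          ‖φ (k + 1)‖ ≤ A / (k + 1 : ℕ) * (|β| / k * (M * ‖S k‖)) * M := by
        gcongr
        · exact h.gain_le _ (by omega)
        · exact h.bounded _ (by omega)
      refine (add_le_add_right h3 _).trans (le_of_eq ?_)
      field_simp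
    have h2 : (fun k : ℕ => ‖S k‖ / ((k : ℝ) * (k + 1 : ℕ))) =O[atTop]
        fun k : ℕ => √(k * Real.log (Real.log k)) / ((k : ℝ) * (k + 1 : ℕ)) := by
      simp only [div_eq_mul_inv]
      exact h.noise.norm_left.mul (isBigO_refl _ _)
    exact h1.trans h2
  · have h1 : (fun k : ℕ => (β / (k : ℝ)) • S k) =O[atTop]
        fun k : ℕ => (1 / (k : ℝ)) • √(k * Real.log (Real.log k)) := by
      refine IsBigO.smul ?_ h.noise
      simp only [div_eq_mul_inv β]
      exact (isBigO_const_mul_self β (fun k : ℕ => (k : ℝ)⁻¹) atTop).trans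
        (by simp only [one_div]; exact isBigO_refl _ _)
    refine h1.congr' (Eventually.of_forall fun k => by simp [hz]) ?_
    filter_upwards [eventually_gt_atTop 0] with k hk
    rw [← sqrt_mul_log_log_div_eq hk, smul_eq_mul, one_div_mul_eq_div]

theorem eventually_le_gain (h : ErrorRecursion φ x a w I M A δ β lam N)
    (hx : Tendsto x atTop (𝓝 0)) {α : ℝ} (hα : α < lam) : ∀ᶠ k in atTop, α ≤ a k := by
  obtain ⟨r, hr1, hr0⟩ :=
    ((h.tendsto_lower.eventually (lt_mem_nhds hα)).and self_mem_nhdsWithin).exists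
  have hr : (0 : ℝ) < r := hr0
  have hev : ∀ᶠ k in atTop, ‖x k‖ < r := by
    have := hx.norm
    rw [norm_zero] at this
    exact this.eventually (gt_mem_nhds hr)
  rw [← map_add_atTop_eq_nat 1, eventually_map]
  filter_upwards [hev] with k hk
  exact hr1.le.trans (h.le_gain k r hr hk.le)

theorem eventually_gain_le (h : ErrorRecursion φ x a w I M A δ β lam N) :
    ∀ᶠ k in atTop, a k ≤ A :=
  eventually_atTop.2 ⟨1, h.gain_le⟩

/-- Boundedness comes first, from positive gains and summable perturbations alone. A bounded error
gives a uniform positive lower bound on the gains, and hence some power rate for z. -/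
theorem tendsto_zero (h : ErrorRecursion φ x a w I M A δ β lam N) : Tendsto x atTop (𝓝 0) := by
  obtain ⟨z, e, hrec, he, hxz⟩ := h.exists_shift
  have hxz0 : Tendsto (fun k => x k - z k) atTop (𝓝 0) :=
    (hxz.trans (sqrt_log_log_div_isBigO_rpow (by norm_num : (1 / 4 : ℝ) < 1 / 2))).trans_tendsto
      (tendsto_one_div_rpow (by norm_num))
  have hsum : Summable fun k => ‖e k‖ := by
    simpa using summable_rpow_mul_of_isBigO (s := 0) (by norm_num) he
  obtain ⟨R, hR⟩ := exists_norm_le_of_summable h.bounded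
    (eventually_atTop.2 ⟨1, fun k hk => (h.gain_pos hk).le⟩) h.eventually_gain_le
    (Eventually.of_forall hrec) hsum
  have hxR : ∀ᶠ k in atTop, ‖x k‖ ≤ |R| + 1 := by
    have := hxz0.norm
    rw [norm_zero] at this
    filter_upwards [this.eventually (gt_mem_nhds one_pos)] with k hk
    have h1 : ‖x k‖ ≤ ‖z k‖ + ‖x k - z k‖ := norm_le_insert' _ _
    linarith [hR k, le_abs_self R]
  have hRpos : 0 < |R| + 1 := by positivity
  have hδ := h.delta_pos
  -- The cap keeps αδ below 1/2, where the weighted perturbations are summable; the rate itself is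
  -- irrelevant here.
  set α := min (I (|R| + 1)) (1 / (4 * δ)) with hα
  have hα0 : 0 < α := lt_min (h.lower_pos _ hRpos) (by positivity)
  have haα : ∀ᶠ k in atTop, α ≤ a k := by
    rw [← map_add_atTop_eq_nat 1, eventually_map]
    filter_upwards [hxR] with k hk
    exact (min_le_left _ _).trans (h.le_gain k _ hRpos hk)
  have hαδ : α * δ < 1 / 2 := by
    have : α * δ ≤ 1 / (4 * δ) * δ := mul_le_mul_of_nonneg_right (min_le_right _ _) hδ.le
    have h2 : 1 / (4 * δ) * δ = 1 / 4 := by field_simp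
    linarith
  have hz := isBigO_rpow_of_summable h.window_pos h.bounded hα0 hδ h.exciting haα
    h.eventually_gain_le (Eventually.of_forall hrec) (summable_rpow_mul_of_isBigO hαδ he)
  have hz0 : Tendsto z atTop (𝓝 0) := hz.trans_tendsto (tendsto_one_div_rpow (by positivity))
  simpa using hxz0.add hz0

theorem isBigO_of_half_lt (h : ErrorRecursion φ x a w I M A δ β lam N) (hη : 1 / 2 < lam * δ) :
    x =O[atTop] fun k : ℕ => √(Real.log (Real.log k) / k) := by
  obtain ⟨z, e, hrec, he, hxz⟩ := h.exists_shift
  have hδ := h.delta_pos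
  -- Above 1/2 the perturbations dominate, so any exponent strictly between 1/2 and min(η, 1) gives
  -- the same rate and nothing is lost by staying below η.
  obtain ⟨η', h1, h2⟩ := exists_between (lt_min hη (by norm_num : (1 / 2 : ℝ) < 1))
  have hαlt : η' / δ < lam := by rw [div_lt_iff₀ hδ]; exact h2.trans_le (min_le_left _ _)
  have hα0 : 0 < η' / δ := div_pos (by linarith) hδ
  have hmul : η' / δ * δ = η' := by field_simp
  have hz := isBigO_sqrt h.window_pos h.bounded hα0 hδ h.exciting
    (h.eventually_le_gain h.tendsto_zero hαlt) h.eventually_gain_le (Eventually.of_forall hrec) he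
    (by rw [hmul]; exact h1) (by rw [hmul]; exact (h2.trans_le (min_le_right _ _)).le)
  simpa using hxz.add hz

theorem exists_shift_isBigO_rpow (h : ErrorRecursion φ x a w I M A δ β lam N) {s : ℝ}
    (hs : s < lam * δ) (hs' : s < 1 / 2) :
    ∃ z e : ℕ → E,
      (∀ k : ℕ, z (k + 1) = z k -
        (a (k + 1) / (k + 1 : ℕ) * inner ℝ (φ (k + 1)) (z k)) • φ (k + 1) + e (k + 1)) ∧
      ((fun k => ‖e k‖) =O[atTop] fun k : ℕ => √(k * Real.log (Real.log k)) / (k : ℝ) ^ 2) ∧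
      ((fun k => x k - z k) =O[atTop] fun k : ℕ => √(Real.log (Real.log k) / k)) ∧
      z =O[atTop] (fun k : ℕ => 1 / (k : ℝ) ^ s) ∧
      x =O[atTop] (fun k : ℕ => 1 / (k : ℝ) ^ s) := by
  obtain ⟨z, e, hrec, he, hxz⟩ := h.exists_shift
  have hδ := h.delta_pos
  have hlam := h.limit_pos
  -- The exponent must also be positive, which s need not be.
  obtain ⟨η', h1, h2⟩ := exists_between (max_lt (lt_min hs hs')
    (lt_min (mul_pos hlam hδ) (by norm_num : (0 : ℝ) < 1 / 2)))
  rw [max_lt_iff] at h1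
  rw [lt_min_iff] at h2
  have hmul : η' / δ * δ = η' := by field_simp
  have hz := isBigO_rpow_of_summable h.window_pos h.bounded (div_pos h1.2 hδ) hδ h.exciting
    (h.eventually_le_gain h.tendsto_zero (by rw [div_lt_iff₀ hδ]; exact h2.1))
    h.eventually_gain_le (Eventually.of_forall hrec)
    (summable_rpow_mul_of_isBigO (by rw [hmul]; exact h2.2) he)
  rw [hmul] at hz
  have hz' := hz.trans (one_div_rpow_isBigO_of_le h1.1.le)
  refine ⟨z, e, hrec, he, hxz, hz', ?_⟩
  simpa using (hxz.trans (sqrt_log_log_div_isBigO_rpow hs')).add hz'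

/-- If the lower bound of the gains is Lipschitz at `0`, the gains may be replaced by ones that are
at least their limiting lower bound, at the expense of a smaller-order perturbation. -/
theorem exists_shift_of_lipschitz (h : ErrorRecursion φ x a w I M A δ β lam N) {L : ℝ}
    (hL : ∀ r, 0 < r → r ≤ 1 → lam - L * r ≤ I r) {s : ℝ} (hs0 : 0 < s)
    (hs : s < lam * δ) (hs' : s < 1 / 2) :
    ∃ (z e e' : ℕ → E) (a' : ℕ → ℝ),
      (∀ k : ℕ, z (k + 1) = z k -
        (a' (k + 1) / (k + 1 : ℕ) * inner ℝ (φ (k + 1)) (z k)) • φ (k + 1) +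
          (e (k + 1) + e' (k + 1))) ∧
      (∀ k, lam ≤ a' k) ∧ (∀ᶠ k in atTop, a' k ≤ max A lam) ∧
      ((fun k => ‖e k‖) =O[atTop] fun k : ℕ => √(k * Real.log (Real.log k)) / (k : ℝ) ^ 2) ∧
      ((fun k => ‖e' k‖) =O[atTop] fun k : ℕ => (k : ℝ) ^ (-1 - 2 * s)) ∧
      ((fun k => x k - z k) =O[atTop] fun k : ℕ => √(Real.log (Real.log k) / k)) := by
  obtain ⟨z, e, hrec, he, hxz, hz, hx⟩ := h.exists_shift_isBigO_rpow hs hs'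
  have hM : 0 ≤ M := (norm_nonneg _).trans (h.bounded 1 le_rfl)
  set a' : ℕ → ℝ := fun k => max (a k) lam with ha'
  set e' : ℕ → E := fun k => ((a' k - a k) / k * inner ℝ (φ k) (z (k - 1))) • φ k with he'
  refine ⟨z, e, e', a', fun k => ?_, fun k => le_max_right _ _, ?_, he, ?_, hxz⟩
  · rw [hrec k]
    simp only [he', Nat.add_sub_cancel]
    module
  · filter_upwards [h.eventually_gain_le] with k hk using max_le_max hk le_rfl
  -- The gain at time k + 1 is controlled by the radius r = c k^(-s) that bounds ‖x k‖, so its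
  -- deficit is at most L r.
  · have hgap : (fun k => a' (k + 1) - a (k + 1)) =O[atTop] fun k : ℕ => 1 / (k : ℝ) ^ s := by
      obtain ⟨c, hc0, hc⟩ := hx.exists_pos
      have hsmall : ∀ᶠ k : ℕ in atTop, c * (1 / (k : ℝ) ^ s) < 1 := by
        have := (tendsto_one_div_rpow hs0).const_mul c
        rw [mul_zero] at this
        exact this.eventually (gt_mem_nhds one_pos)
      refine IsBigO.of_bound (|L| * c) ?_
      filter_upwards [hc.bound, hsmall, eventually_gt_atTop 0] with k hk hk1 hk0
      have hk' : (0 : ℝ) < k := by exact_mod_cast hk0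
      rw [Real.norm_eq_abs, abs_of_nonneg (by positivity)] at hk
      have hr : 0 < c * (1 / (k : ℝ) ^ s) := by positivity
      have h1 := (hL _ hr hk1.le).trans (h.le_gain k _ hr hk)
      rw [Real.norm_eq_abs, Real.norm_eq_abs,
        abs_of_nonneg (a := a' (k + 1) - a (k + 1)) (sub_nonneg.2 (le_max_left _ _)),
        abs_of_nonneg (a := 1 / (k : ℝ) ^ s) (by positivity), mul_assoc]
      have h2 : L * (c * (1 / (k : ℝ) ^ s)) ≤ |L| * (c * (1 / (k : ℝ) ^ s)) :=
        mul_le_mul_of_nonneg_right (le_abs_self L) hr.le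
      have h3 : 0 ≤ |L| * (c * (1 / (k : ℝ) ^ s)) := by positivity
      simp only [ha']
      rcases max_cases (a (k + 1)) lam with hm | hm <;> rw [hm.1] <;> linarith
    have hbd : (fun k : ℕ => ‖e' (k + 1)‖) =O[atTop]
        fun k : ℕ => (a' (k + 1) - a (k + 1)) * ‖z k‖ * (k : ℝ)⁻¹ := by
      refine IsBigO.of_bound (M ^ 2) ?_
      filter_upwards [eventually_gt_atTop 0] with k hk
      have hk' : (0 : ℝ) < k := by exact_mod_cast hk
      have hkk : (k : ℝ) ≤ (k + 1 : ℕ) := by exact_mod_cast (by omega)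
      have hg : 0 ≤ a' (k + 1) - a (k + 1) := sub_nonneg.2 (le_max_left _ _)
      have hk1 : (0 : ℝ) < (k + 1 : ℕ) := by positivity
      simp only [he', Nat.add_sub_cancel]
      rw [norm_norm, norm_smul, Real.norm_eq_abs, Real.norm_eq_abs, abs_mul,
        abs_of_nonneg (div_nonneg hg hk1.le), abs_of_nonneg (a := _ * (k : ℝ)⁻¹) (by positivity)]
      have h2 : |inner ℝ (φ (k + 1)) (z k)| ≤ M * ‖z k‖ :=
        (abs_real_inner_le_norm _ _).trans
          (mul_le_mul_of_nonneg_right (h.bounded _ (by omega)) (norm_nonneg _))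
      calc (a' (k + 1) - a (k + 1)) / (k + 1 : ℕ) * |inner ℝ (φ (k + 1)) (z k)| * ‖φ (k + 1)‖
          ≤ (a' (k + 1) - a (k + 1)) / k * (M * ‖z k‖) * M := by
            gcongr
            exact h.bounded _ (by omega)
        _ = _ := by ring
    refine isBigO_of_succ (hbd.trans (((hgap.mul hz.norm_left).mul
      (isBigO_refl (fun k : ℕ => (k : ℝ)⁻¹) atTop)).trans ?_))
    refine IsBigO.of_bound (2 ^ (1 + 2 * s)) ?_
    filter_upwards [eventually_gt_atTop 0] with k hk
    have hk' : (0 : ℝ) < k := by exact_mod_cast hk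
    have hk2 : ((k + 1 : ℕ) : ℝ) ≤ 2 * k := by exact_mod_cast (by omega)
    have hk1 : (0 : ℝ) < (k + 1 : ℕ) := by positivity
    rw [Real.norm_eq_abs, Real.norm_eq_abs, abs_of_nonneg (by positivity),
      abs_of_nonneg (by positivity)]
    have h1 : 1 / (k : ℝ) ^ s * (1 / (k : ℝ) ^ s) * (k : ℝ)⁻¹ = ((k : ℝ) ^ (1 + 2 * s))⁻¹ := by
      rw [Real.rpow_add hk', Real.rpow_one, two_mul, Real.rpow_add hk']
      field_simp
    rw [h1, show -1 - 2 * s = -(1 + 2 * s) by ring, Real.rpow_neg hk1.le, ← div_eq_mul_inv,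
      le_div_iff₀ (by positivity), inv_mul_le_iff₀ (by positivity),
      ← Real.mul_rpow hk'.le (by norm_num), mul_comm (k : ℝ)]
    exact Real.rpow_le_rpow hk1.le hk2 (by linarith)

theorem isBigO_of_lt_half_of_lipschitz (h : ErrorRecursion φ x a w I M A δ β lam N) {L : ℝ}
    (hL : ∀ r, 0 < r → r ≤ 1 → lam - L * r ≤ I r) (hη : lam * δ < 1 / 2) :
    x =O[atTop] fun k : ℕ => 1 / (k : ℝ) ^ (lam * δ) := by
  have hpos : 0 < lam * δ := mul_pos h.limit_pos h.delta_pos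
  -- With s = 3η/4 the new perturbation weighted by k^η is of order k^(-1-η/2), hence summable; any
  -- s strictly between η/2 and η would do.
  obtain ⟨z, e, e', a', hrec, ha', haA, he, he', hxz⟩ :=
    h.exists_shift_of_lipschitz hL (s := 3 / 4 * (lam * δ)) (by linarith) (by linarith)
      (by linarith)
  have h2 : Summable fun k : ℕ => (k : ℝ) ^ (lam * δ) * ‖e' k‖ := by
    have h3 := (isBigO_refl (fun k : ℕ => (k : ℝ) ^ (lam * δ)) atTop).mul he'
    refine summable_of_isBigO_nat
      (Real.summable_nat_rpow.2 (by linarith : -1 - (lam * δ) / 2 < -1)) (h3.trans_eventuallyEq ?_)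
    filter_upwards [eventually_gt_atTop 0] with k hk
    have hk' : (0 : ℝ) < k := by exact_mod_cast hk
    rw [← Real.rpow_add hk']
    congr 1; ring
  have hsum : Summable fun k : ℕ => (k : ℝ) ^ (lam * δ) * ‖e k + e' k‖ := by
    refine Summable.of_nonneg_of_le (fun k => by positivity) (fun k => ?_)
      ((summable_rpow_mul_of_isBigO hη he).add h2)
    rw [← mul_add]
    exact mul_le_mul_of_nonneg_left (norm_add_le _ _) (by positivity)
  have hz := isBigO_rpow_of_summable h.window_pos h.bounded h.limit_pos h.delta_pos h.exciting
    (Eventually.of_forall ha') haA (Eventually.of_forall hrec) hsum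
  simpa using (hxz.trans (sqrt_log_log_div_isBigO_rpow hη)).add hz

theorem isBigO_of_eq_half_of_lipschitz (h : ErrorRecursion φ x a w I M A δ β lam N) {L : ℝ}
    (hL : ∀ r, 0 < r → r ≤ 1 → lam - L * r ≤ I r) (hη : lam * δ = 1 / 2) :
    x =O[atTop] fun k : ℕ => Real.log k * √(Real.log (Real.log k) / k) := by
  -- Any s in [1/4, 1/2) works: k^(-1-2s) is then no larger than the k^(-3/2) already present.
  obtain ⟨z, e, e', a', hrec, ha', haA, he, he', hxz⟩ :=
    h.exists_shift_of_lipschitz hL (s := 2 / 5) (by norm_num) (by rw [hη]; norm_num) (by norm_num)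
  have h1 : (fun k => ‖e' k‖) =O[atTop]
      fun k : ℕ => √(k * Real.log (Real.log k)) / (k : ℝ) ^ 2 := by
    refine he'.trans (IsBigO.of_bound 1 ?_)
    filter_upwards [eventually_gt_atTop 0, eventually_one_le_log_log] with k hk hll
    have hk1 : (1 : ℝ) ≤ k := by exact_mod_cast hk
    rw [one_mul, Real.norm_eq_abs, Real.norm_eq_abs, abs_of_nonneg (by positivity),
      abs_of_nonneg (by positivity)]
    have h2 := rpow_mul_sqrt_mul_log_log_div_sq hk 0
    rw [Real.rpow_zero, one_mul] at h2
    rw [h2]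
    calc (k : ℝ) ^ (-1 - 2 * (2 / 5) : ℝ) ≤ (k : ℝ) ^ (0 - 3 / 2 : ℝ) :=
          Real.rpow_le_rpow_of_exponent_le hk1 (by norm_num)
      _ ≤ _ := le_mul_of_one_le_left (by positivity) (Real.one_le_sqrt.2 hll)
  have hsum : (fun k => ‖e k + e' k‖) =O[atTop]
      fun k : ℕ => √(k * Real.log (Real.log k)) / (k : ℝ) ^ 2 :=
    (he.of_norm_left.add h1.of_norm_left).norm_left
  have hz := isBigO_log_mul_sqrt h.window_pos h.bounded h.limit_pos h.delta_pos h.exciting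
    (Eventually.of_forall ha') haA (Eventually.of_forall hrec) hsum hη
  have hxz' : (fun k => x k - z k) =O[atTop]
      fun k : ℕ => Real.log k * √(Real.log (Real.log k) / k) := by
    refine hxz.trans (IsBigO.of_bound 1 ?_)
    have hlog1 : ∀ᶠ k : ℕ in atTop, 1 ≤ Real.log (k : ℝ) :=
      (Real.tendsto_log_atTop.comp tendsto_natCast_atTop_atTop).eventually_ge_atTop 1
    filter_upwards [hlog1] with k hk
    rw [one_mul, norm_mul]
    exact le_mul_of_one_le_left (norm_nonneg _) (hk.trans (le_abs_self _))
  simpa using hxz'.add hz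

end ErrorRecursion

end ErrorRecursion

/-! ### Secant slopes of the distribution function -/

section Slope

/-- The secant slope of `F` between `c - y` and `c`, with the value `K` if `y = 0`. -/
noncomputable def secantSlope (F : ℝ → ℝ) (K c y : ℝ) : ℝ :=
  if y = 0 then K else (F c - F (c - y)) / y

theorem secantSlope_mul (F : ℝ → ℝ) (K c y : ℝ) :
    secantSlope F K c y * y = F c - F (c - y) := by
  unfold secantSlope
  split_ifs with h
  · simp [h]
  · field_simp

theorem secantSlope_le {F : ℝ → ℝ} {K : NNReal} (hF : LipschitzWith K F) (c y : ℝ) :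
    secantSlope F K c y ≤ K := by
  unfold secantSlope
  split_ifs with h
  · exact le_rfl
  · refine (le_abs_self _).trans ?_
    rw [abs_div, div_le_iff₀ (abs_pos.2 h)]
    simpa [Real.dist_eq] using hF.dist_le_mul c (c - y)

theorem le_secantSlope {F : ℝ → ℝ} {K : NNReal} (hF : LipschitzWith K F) {ℓ p q c y : ℝ}
    (hpq : p < q) (hgrow : ∀ u v, p ≤ u → u ≤ v → v ≤ q → ℓ * (v - u) ≤ F v - F u)
    (hc : c ∈ Set.Icc p q) (hcy : c - y ∈ Set.Icc p q) : ℓ ≤ secantSlope F K c y := by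
  unfold secantSlope
  split_ifs with h
  -- At y = 0 the slope is the Lipschitz constant, which dominates the growth rate ℓ on the
  -- nondegenerate interval [p, q].
  · have h1 := hgrow p q le_rfl hpq.le le_rfl
    have h2 := hF.dist_le_mul q p
    rw [Real.dist_eq, Real.dist_eq, abs_of_pos (sub_pos.2 hpq)] at h2
    exact le_of_mul_le_mul_right (h1.trans ((le_abs_self _).trans h2)) (sub_pos.2 hpq)
  · rcases lt_or_gt_of_ne h with hy | hy
    · have h1 := hgrow c (c - y) hc.1 (by linarith) hcy.2
      rw [le_div_iff_of_neg hy]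
      linarith
    · have h1 := hgrow (c - y) c hcy.1 (by linarith) hc.2
      rw [le_div_iff₀ hy]
      linarith

end Slope

/-! ### Lower bounds from the density, and excitation as a quadratic form -/

namespace NoiseAssumption

variable {Ω : Type*} [MeasurableSpace Ω] {μ : Measure Ω} {d : ℕ → Ω → ℝ} {F f : ℝ → ℝ}

theorem density_pos (hd : NoiseAssumption μ d F f) (x : ℝ) : 0 < f x := by
  obtain ⟨c, hc, h⟩ := hd.density_inf_pos (Set.Ioo (x - 1) (x + 1)) isOpen_Ioo
    (Metric.isBounded_Ioo _ _)
  exact hc.trans_le (h x ⟨by linarith, by linarith⟩)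

theorem bddBelow_image (hd : NoiseAssumption μ d F f) (s : Set ℝ) : BddBelow (f '' s) :=
  ⟨0, by rintro _ ⟨x, -, rfl⟩; exact (hd.density_pos x).le⟩

theorem sInf_image_pos (hd : NoiseAssumption μ d F f) {p q : ℝ} (hpq : p ≤ q) :
    0 < sInf (f '' Set.Icc p q) := by
  obtain ⟨c, hc, h⟩ := hd.density_inf_pos (Set.Ioo (p - 1) (q + 1)) isOpen_Ioo
    (Metric.isBounded_Ioo _ _)
  refine hc.trans_le (le_csInf ((Set.nonempty_Icc.2 hpq).image f) ?_)
  rintro _ ⟨x, hx, rfl⟩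
  exact h x ⟨by linarith [hx.1], by linarith [hx.2]⟩

/-- The increment of `F` is the mass of (u, v], that is, the integral of the density there. -/
theorem mul_sub_le_sub [IsProbabilityMeasure μ] (hd : NoiseAssumption μ d F f) {p q u v : ℝ}
    (hpu : p ≤ u) (huv : u ≤ v) (hvq : v ≤ q) :
    sInf (f '' Set.Icc p q) * (v - u) ≤ F v - F u := by
  have hm := hd.measurable 1 le_rfl
  have : IsProbabilityMeasure (μ.map (d 1)) := Measure.isProbabilityMeasure_map hm.aemeasurable
  have hF : ∀ x, F x = (μ.map (d 1)).real (Set.Iic x) := fun x => by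
    rw [hd.distribution, map_measureReal_apply hm measurableSet_Iic]; rfl
  have hdiff : F v - F u = (μ.map (d 1)).real (Set.Ioc u v) := by
    rw [hF, hF, ← measureReal_sdiff (Set.Iic_subset_Iic.2 huv) measurableSet_Iic]
    congr 1
    ext x
    simp [and_comm]
  set ℓ := sInf (f '' Set.Icc p q) with hℓ
  have hℓ0 : 0 ≤ ℓ := (hd.sInf_image_pos (hpu.trans (huv.trans hvq))).le
  have hle : ENNReal.ofReal (ℓ * (v - u)) ≤ (μ.map (d 1)) (Set.Ioc u v) := by
    rw [hd.density, withDensity_apply _ measurableSet_Ioc, ENNReal.ofReal_mul hℓ0,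
      ← Real.volume_Ioc, ← setLIntegral_const]
    refine setLIntegral_mono hd.density_measurable.ennreal_ofReal fun x hx => ?_
    exact ENNReal.ofReal_le_ofReal (csInf_le (hd.bddBelow_image _)
      ⟨x, ⟨hpu.trans hx.1.le, hx.2.trans hvq⟩, rfl⟩)
  rw [hdiff]
  exact (ENNReal.ofReal_le_iff_le_toReal (measure_ne_top _ _)).1 hle

theorem tendsto_sInf (hd : NoiseAssumption μ d F f) (C : ℝ) {a : ℝ} (ha : 0 ≤ a) :
    Tendsto (fun z => sInf (f '' Set.Icc (C - z) (C + z))) (𝓝[>] a)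
      (𝓝 (lowerDensity f C a)) :=
  tendsto_lowerDensity (fun x => (hd.density_pos x).le) C ha

theorem sInf_le_lowerDensity (hd : NoiseAssumption μ d F f) (C : ℝ) {a z : ℝ} (ha : 0 ≤ a)
    (hz : a < z) : sInf (f '' Set.Icc (C - z) (C + z)) ≤ lowerDensity f C a := by
  refine ge_of_tendsto (hd.tendsto_sInf C ha) ?_
  filter_upwards [Ioo_mem_nhdsGT hz] with z' hz'
  refine csInf_le_csInf (hd.bddBelow_image _)
    ((Set.nonempty_Icc.2 (by linarith [hz'.1])).image f) ?_
  exact Set.image_mono (Set.Icc_subset_Icc (by linarith [hz'.2]) (by linarith [hz'.2]))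

theorem lowerDensity_le (hd : NoiseAssumption μ d F f) {C a t : ℝ} (ha : 0 ≤ a)
    (ht : t ∈ Set.Icc (C - a) (C + a)) : lowerDensity f C a ≤ f t := by
  refine le_of_tendsto (hd.tendsto_sInf C ha) ?_
  filter_upwards [self_mem_nhdsWithin] with z hz
  have hz' : a < z := hz
  exact csInf_le (hd.bddBelow_image _) ⟨t, ⟨by linarith [ht.1], by linarith [ht.2]⟩, rfl⟩

theorem exists_sub_mul_le_sInf (hd : NoiseAssumption μ d F f) (hf : LocallyLipschitz f) (C : ℝ)
    {a b : ℝ} (ha : 0 ≤ a) : ∃ L, ∀ z, a ≤ z → z ≤ b →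
      lowerDensity f C a - L * (z - a) ≤ sInf (f '' Set.Icc (C - z) (C + z)) := by
  obtain ⟨K, hK⟩ := (hf.locallyLipschitzOn (s := Set.Icc (C - b)
    (C + b))).exists_lipschitzOnWith_of_compact isCompact_Icc
  refine ⟨K, fun z haz hzb => le_csInf ((Set.nonempty_Icc.2 (by linarith)).image f) ?_⟩
  rintro _ ⟨t, ht, rfl⟩
  -- The projection of t onto the smaller interval, which moves t by at most z - a.
  set t' := max (C - a) (min t (C + a)) with ht'
  have ht'mem : t' ∈ Set.Icc (C - a) (C + a) :=
    ⟨le_max_left _ _, max_le (by linarith) (min_le_right _ _)⟩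
  have hdist : |t' - t| ≤ z - a := by
    have h1 := ht.1
    have h2 := ht.2
    rw [abs_le]
    rcases max_cases (C - a) (min t (C + a)) with h | h <;>
    rcases min_cases t (C + a) with h' | h' <;> constructor <;> linarith
  have h1 := hK.dist_le_mul t' ⟨by linarith [ht'mem.1], by linarith [ht'mem.2]⟩ t
    ⟨by linarith [ht.1], by linarith [ht.2]⟩
  rw [Real.dist_eq, Real.dist_eq] at h1
  have h2 := hd.lowerDensity_le ha ht'mem
  have h3 : (K : ℝ) * |t' - t| ≤ K * (z - a) := mul_le_mul_of_nonneg_left hdist K.2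
  linarith [le_abs_self (f t' - f t)]

end NoiseAssumption

theorem PersistentExcitation.le_sum_inner_sq {n : ℕ} {φ : ℕ → EuclideanSpace ℝ (Fin n)}
    {M δ : ℝ} {N : ℕ} (hφ : PersistentExcitation φ M δ N) {k : ℕ} (hk : 1 ≤ k)
    (v : EuclideanSpace ℝ (Fin n)) :
    N * δ * ‖v‖ ^ 2 ≤ ∑ i ∈ Finset.range N, (inner ℝ (φ (k + i)) v) ^ 2 := by
  have hN : (0 : ℝ) < N := by exact_mod_cast hφ.window_pos
  have h := (hφ.exciting k hk).dotProduct_mulVec_nonneg v.ofLp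
  have hinner : ∀ i, inner ℝ (φ i) v = (φ i).ofLp ⬝ᵥ v.ofLp := fun i => by
    rw [EuclideanSpace.inner_eq_star_dotProduct, dotProduct_comm]; simp
  have hnorm : ‖v‖ ^ 2 = v.ofLp ⬝ᵥ v.ofLp := by
    rw [← real_inner_self_eq_norm_sq, EuclideanSpace.inner_eq_star_dotProduct]; simp
  rw [star_trivial, Matrix.sub_mulVec, dotProduct_sub, Matrix.smul_mulVec, Matrix.smul_mulVec,
    Matrix.one_mulVec, dotProduct_smul, dotProduct_smul, Matrix.sum_mulVec, dotProduct_sum,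
    ← hnorm] at h
  have hterm : ∀ i, v.ofLp ⬝ᵥ (Matrix.vecMulVec (φ i).ofLp (φ i).ofLp).mulVec v.ofLp =
      (inner ℝ (φ i) v) ^ 2 := fun i => by
    rw [Matrix.vecMulVec_mulVec, dotProduct_smul, hinner, dotProduct_comm v.ofLp]
    simp [sq]
  simp only [hterm] at h
  rw [Finset.sum_Ico_eq_sum_range, Nat.add_sub_cancel_left, smul_eq_mul, smul_eq_mul, sub_nonneg,
    one_div, ← div_eq_inv_mul, le_div_iff₀ hN] at h
  linarith

/-! ### The noise in the binary observations -/

section Noise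

variable {Ω : Type*} [MeasurableSpace Ω] {μ : Measure Ω} [IsProbabilityMeasure μ]
  {n : ℕ} {φ : ℕ → EuclideanSpace ℝ (Fin n)} {θ : EuclideanSpace ℝ (Fin n)}
  {d : ℕ → Ω → ℝ} {F f : ℝ → ℝ} {C M : ℝ}

theorem isBigO_of_apply {u : ℕ → EuclideanSpace ℝ (Fin n)} {g : ℕ → ℝ}
    (h : ∀ j, (fun k => u k j) =O[atTop] g) : u =O[atTop] g := by
  have hu : u = fun k => ∑ j, u k j • EuclideanSpace.single j (1 : ℝ) := by
    funext k
    simpa using ((EuclideanSpace.basisFun (Fin n) ℝ).sum_repr (u k)).symm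
  rw [hu]
  have hterm : ∀ j ∈ Finset.univ,
      (fun k => u k j • (EuclideanSpace.single j 1 : EuclideanSpace ℝ (Fin n))) =O[atTop] g :=
    fun j _ => IsBigO.trans (IsBigO.of_bound 1 (Eventually.of_forall fun k => by
      simp [norm_smul])) (h j)
  exact IsBigO.fun_sum hterm

/-- The centred binary observations, weighted by the regressors, obey the bound of the law of the
iterated logarithm. -/
theorem ae_sum_noise_isBigO (hφ : ∀ k, 1 ≤ k → ‖φ k‖ ≤ M) (hd : NoiseAssumption μ d F f) :
    ∀ᵐ ω ∂μ, (fun k => ∑ i ∈ Finset.range k,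
      (F (C - inner ℝ (φ (i + 1)) θ) - observation φ θ d C (i + 1) ω) • φ (i + 1)) =O[atTop]
      fun k : ℕ => √(k * Real.log (Real.log k)) := by
  have hmeas : ∀ (j : Fin n) (i : ℕ), Measurable fun x : ℝ =>
      (F (C - inner ℝ (φ (i + 1)) θ) - if inner ℝ (φ (i + 1)) θ + x ≤ C then 1 else 0) *
        φ (i + 1) j := fun j i =>
    (measurable_const.sub (Measurable.ite
      (measurableSet_le (measurable_const.add measurable_id) measurable_const)
      measurable_const measurable_const)).mul_const _
  have hF01 : ∀ x, 0 ≤ F x ∧ F x ≤ 1 := fun x => by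
    rw [hd.distribution]; exact ⟨measureReal_nonneg, measureReal_le_one⟩
  have hcoord : ∀ j : Fin n, ∀ᵐ ω ∂μ, (fun k => ∑ i ∈ Finset.range k,
      (F (C - inner ℝ (φ (i + 1)) θ) - observation φ θ d C (i + 1) ω) * φ (i + 1) j) =O[atTop]
      fun k : ℕ => √(k * Real.log (Real.log k)) := by
    intro j
    refine ae_sum_isBigO_sqrt_mul_log_log (B := M) (X := fun i ω =>
      (F (C - inner ℝ (φ (i + 1)) θ) - observation φ θ d C (i + 1) ω) * φ (i + 1) j)
      (fun i => (hmeas j i).comp (hd.measurable (i + 1) (by omega)))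
      (hd.indep.comp _ (hmeas j)) (fun i ω => ?_) fun i => ?_
    · have h1 : |F (C - inner ℝ (φ (i + 1)) θ) - observation φ θ d C (i + 1) ω| ≤ 1 := by
        obtain ⟨h0, h1⟩ := hF01 (C - inner ℝ (φ (i + 1)) θ)
        unfold observation
        rw [abs_le]
        split_ifs <;> constructor <;> linarith
      have h2 : |φ (i + 1) j| ≤ M :=
        (PiLp.norm_apply_le (φ (i + 1)) j).trans (hφ _ (by omega))
      rw [abs_mul]
      calc _ ≤ 1 * M := mul_le_mul h1 h2 (abs_nonneg _) zero_le_one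
        _ = M := one_mul M
    · set c := C - inner ℝ (φ (i + 1)) θ with hc
      have hset : MeasurableSet {ω | d (i + 1) ω ≤ c} :=
        measurableSet_le (hd.measurable (i + 1) (by omega)) measurable_const
      have hobs : observation φ θ d C (i + 1) =
          Set.indicator {ω | d (i + 1) ω ≤ c} fun _ => (1 : ℝ) := by
        funext ω
        simp only [observation, output, Set.indicator_apply, hc, Set.mem_ofPred_eq,
          le_sub_iff_add_le']
        congr
      have hprob : μ.real {ω | d (i + 1) ω ≤ c} = F c := by
        rw [hd.distribution]
        have := (hd.identDistrib (i + 1) (by omega)).measure_mem_eq (measurableSet_Iic (a := c))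
        exact congrArg ENNReal.toReal this
      rw [integral_mul_const, integral_sub (integrable_const _), hobs,
        integral_indicator_const _ hset, hprob]
      · simp
      · rw [hobs]
        exact (integrable_const _).indicator hset
  filter_upwards [ae_all_iff.2 hcoord] with ω hω
  refine isBigO_of_apply fun j => ?_
  simpa using hω j

end Noise

/-! ### From the algorithm to the error recursion -/

section Assembly

variable {Ω : Type*} [MeasurableSpace Ω] {μ : Measure Ω}
  {n : ℕ} {φ : ℕ → EuclideanSpace ℝ (Fin n)} {θ : EuclideanSpace ℝ (Fin n)}
  {d : ℕ → Ω → ℝ} {F f : ℝ → ℝ} {C M δ β : ℝ} {N : ℕ} {θ₀ : Ω → EuclideanSpace ℝ (Fin n)}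

/-- Adding and subtracting the true probability `F (C - ⟪φ, θ⟫)` splits the innovation into a secant
slope times ⟪φ, x⟫ and a centred noise. -/
theorem errorRecursion_estimationError [IsProbabilityMeasure μ] (hφ : PersistentExcitation φ M δ N)
    (hd : NoiseAssumption μ d F f) (hβ : 0 < β) {K : NNReal} (hK : LipschitzWith K F) {ω : Ω}
    (hω : (fun k => ∑ i ∈ Finset.range k,
      (F (C - inner ℝ (φ (i + 1)) θ) - observation φ θ d C (i + 1) ω) • φ (i + 1)) =O[atTop]
      fun k : ℕ => √(k * Real.log (Real.log k))) :
    ErrorRecursion φ (fun k => estimationError β C F φ θ d θ₀ k ω)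
      (fun k => β * secantSlope F K (C - inner ℝ (φ k) θ)
        (inner ℝ (φ k) (estimationError β C F φ θ d θ₀ (k - 1) ω)))
      (fun k => F (C - inner ℝ (φ k) θ) - observation φ θ d C k ω)
      (fun r => β * sInf (f '' Set.Icc (C - (M * ‖θ‖ + (M + 1) * r))
        (C + (M * ‖θ‖ + (M + 1) * r))))
      M (β * K) δ β (β * lowerDensity f C (M * ‖θ‖)) N := by
  have hM : 0 ≤ M := (norm_nonneg _).trans (hφ.bounded 1 le_rfl)
  have hMθ : 0 ≤ M * ‖θ‖ := by positivity
  refine ⟨hφ.window_pos, hφ.bounded, hφ.delta_pos, fun k hk v => hφ.le_sum_inner_sq hk v,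
    fun k => ?_, hω, fun k _ => ?_, fun k r hr hxr => ?_, fun r hr => ?_, ?_, fun r hr => ?_⟩
  · set x := estimationError β C F φ θ d θ₀ k ω with hx
    have hest : estimate β C F φ θ d θ₀ k ω = x + θ := by rw [hx, estimationError]; abel
    have hs := secantSlope_mul F K (C - inner ℝ (φ (k + 1)) θ) (inner ℝ (φ (k + 1)) x)
    have hsucc : estimate β C F φ θ d θ₀ (k + 1) ω = estimate β C F φ θ d θ₀ k ω +
        (β / ((k + 1 : ℕ) : ℝ) * (F (C - inner ℝ (φ (k + 1)) (estimate β C F φ θ d θ₀ k ω)) -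
          observation φ θ d C (k + 1) ω)) • φ (k + 1) := rfl
    have harg : C - inner ℝ (φ (k + 1)) (x + θ) =
        C - inner ℝ (φ (k + 1)) θ - inner ℝ (φ (k + 1)) x := by
      rw [inner_add_right]; ring
    have hF : F (C - inner ℝ (φ (k + 1)) (x + θ)) = F (C - inner ℝ (φ (k + 1)) θ) -
        secantSlope F K (C - inner ℝ (φ (k + 1)) θ) (inner ℝ (φ (k + 1)) x) *
          inner ℝ (φ (k + 1)) x := by
      rw [hs, harg]; ring
    have hgoal : estimationError β C F φ θ d θ₀ (k + 1) ω =
        estimate β C F φ θ d θ₀ (k + 1) ω - θ := rfl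
    rw [hgoal, hsucc, hest, hF, Nat.add_sub_cancel, ← hx]
    module
  · exact mul_le_mul_of_nonneg_left (secantSlope_le hK _ _) hβ.le
  · refine mul_le_mul_of_nonneg_left ?_ hβ.le
    have h1 : |inner ℝ (φ (k + 1)) θ| ≤ M * ‖θ‖ := (abs_real_inner_le_norm _ _).trans
      (mul_le_mul_of_nonneg_right (hφ.bounded _ (by omega)) (norm_nonneg _))
    have h2 : |inner ℝ (φ (k + 1)) (estimationError β C F φ θ d θ₀ k ω)| ≤ M * r :=
      (abs_real_inner_le_norm _ _).trans
        (mul_le_mul (hφ.bounded _ (by omega)) hxr (norm_nonneg _) hM)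
    -- Both ends of the secant lie within M‖θ‖ + M r of C; using M + 1 keeps the radius strictly
    -- above M‖θ‖ even when M = 0, as the one-sided limit requires.
    have h3 : 0 < (M + 1) * r := by positivity
    rw [abs_le] at h1 h2
    rw [Nat.add_sub_cancel]
    refine le_secantSlope hK (by linarith) (fun u v hu huv hv => hd.mul_sub_le_sub hu huv hv)
      ⟨by linarith, by linarith⟩ ⟨by linarith, by linarith⟩
  · have h3 : 0 < (M + 1) * r := by positivity
    exact mul_pos hβ (hd.sInf_image_pos (by linarith))
  · refine Tendsto.const_mul β ((hd.tendsto_sInf C hMθ).comp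
      (f := fun r => M * ‖θ‖ + (M + 1) * r) (tendsto_nhdsWithin_iff.2 ⟨?_, ?_⟩))
    · refine tendsto_nhdsWithin_of_tendsto_nhds ?_
      have : Continuous fun r : ℝ => M * ‖θ‖ + (M + 1) * r := by fun_prop
      simpa using this.tendsto 0
    · filter_upwards [self_mem_nhdsWithin] with r hr
      have hr' : (0 : ℝ) < r := hr
      have h3 : 0 < (M + 1) * r := by positivity
      exact lt_add_of_pos_right _ h3
  · have h3 : 0 < (M + 1) * r := by positivity
    exact mul_le_mul_of_nonneg_left (hd.sInf_le_lowerDensity C hMθ (by linarith)) hβ.le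

theorem exists_lower_lipschitz (hd : NoiseAssumption μ d F f) (hf : LocallyLipschitz f)
    (hM : 0 ≤ M) (hβ : 0 ≤ β) :
    ∃ L, ∀ r, 0 < r → r ≤ 1 → β * lowerDensity f C (M * ‖θ‖) - L * r ≤
      β * sInf (f '' Set.Icc (C - (M * ‖θ‖ + (M + 1) * r)) (C + (M * ‖θ‖ + (M + 1) * r))) := by
  obtain ⟨L, hL⟩ := hd.exists_sub_mul_le_sInf hf C (a := M * ‖θ‖) (b := M * ‖θ‖ + (M + 1))
    (by positivity)
  refine ⟨β * (L * (M + 1)), fun r hr hr1 => ?_⟩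
  have h3 : 0 ≤ (M + 1) * r := by positivity
  have h4 : (M + 1) * r ≤ M + 1 := mul_le_of_le_one_right (by positivity) hr1
  have h := mul_le_mul_of_nonneg_left
    (hL (M * ‖θ‖ + (M + 1) * r) (by linarith) (by linarith)) hβ
  calc _ = β * (lowerDensity f C (M * ‖θ‖) - L * (M * ‖θ‖ + (M + 1) * r - M * ‖θ‖)) := by ring
    _ ≤ _ := h

end Assembly

end SetValued

theorem theorem5 {Ω : Type*} [MeasurableSpace Ω] (μ : Measure Ω) [IsProbabilityMeasure μ]
    {n : ℕ} (φ : ℕ → EuclideanSpace ℝ (Fin n)) (θ : EuclideanSpace ℝ (Fin n))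
    (d : ℕ → Ω → ℝ) (F f : ℝ → ℝ) (C M δ β η : ℝ) (N : ℕ)
    (θ₀ : Ω → EuclideanSpace ℝ (Fin n))
    (hφ : SetValued.PersistentExcitation φ M δ N)
    (hd : SetValued.NoiseAssumption μ d F f)
    (hβ : 0 < β)
    (hη : η = β * δ * SetValued.lowerDensity f C (M * ‖θ‖)) :
    (∀ ε : ℝ, 0 < ε → ∀ᵐ ω ∂μ,
      (1 / 2 < η →
        (fun k : ℕ => SetValued.estimationError β C F φ θ d θ₀ k ω) =O[atTop]
          (fun k : ℕ => √(Real.log (Real.log (k : ℝ)) / (k : ℝ)))) ∧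
      (η ≤ 1 / 2 →
        (fun k : ℕ => SetValued.estimationError β C F φ θ d θ₀ k ω) =O[atTop]
          (fun k : ℕ => 1 / (k : ℝ) ^ (η - ε)))) ∧
    (LocallyLipschitz f → ∀ᵐ ω ∂μ,
      (1 / 2 < η →
        (fun k : ℕ => SetValued.estimationError β C F φ θ d θ₀ k ω) =O[atTop]
          (fun k : ℕ => √(Real.log (Real.log (k : ℝ)) / (k : ℝ)))) ∧
      (η = 1 / 2 →
        (fun k : ℕ => SetValued.estimationError β C F φ θ d θ₀ k ω) =O[atTop]
          (fun k : ℕ => Real.log (k : ℝ) * √(Real.log (Real.log (k : ℝ)) / (k : ℝ)))) ∧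
      (η < 1 / 2 →
        (fun k : ℕ => SetValued.estimationError β C F φ θ d θ₀ k ω) =O[atTop]
          (fun k : ℕ => 1 / (k : ℝ) ^ η))) := by
  obtain ⟨K, hK⟩ := hd.lipschitz
  have hM : 0 ≤ M := (norm_nonneg _).trans (hφ.bounded 1 le_rfl)
  have hη' : β * SetValued.lowerDensity f C (M * ‖θ‖) * δ = η := by rw [hη]; ring
  refine ⟨fun ε hε => ?_, fun hf => ?_⟩
  · filter_upwards [SetValued.ae_sum_noise_isBigO (C := C) (θ := θ) hφ.bounded hd] with ω hω
    have h := SetValued.errorRecursion_estimationError (θ₀ := θ₀) hφ hd hβ hK hω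
    refine ⟨fun h1 => h.isBigO_of_half_lt (by rwa [hη']), fun h1 => ?_⟩
    obtain ⟨z, e, -, -, -, -, hx⟩ := h.exists_shift_isBigO_rpow (s := η - ε)
      (by rw [hη']; linarith) (by linarith)
    exact hx
  · obtain ⟨L, hL⟩ := SetValued.exists_lower_lipschitz (C := C) (θ := θ) hd hf hM hβ.le
    filter_upwards [SetValued.ae_sum_noise_isBigO (C := C) (θ := θ) hφ.bounded hd] with ω hω
    have h := SetValued.errorRecursion_estimationError (θ₀ := θ₀) hφ hd hβ hK hω
    refine ⟨fun h1 => h.isBigO_of_half_lt (by rwa [hη']),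
      fun h1 => h.isBigO_of_eq_half_of_lipschitz hL (by rwa [hη']), fun h1 => ?_⟩
    rw [← hη'] at h1 ⊢
    exact h.isBigO_of_lt_half_of_lipschitz hL h1
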